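/- Let $X_1,X_2,\dots$ be real random variables on a probability space such that for every $n$ all $n!$ strict orderings of $X_1,\dots,X_n$ are equally likely, each having probability $1/n!$ (for instance, i.i.d. random variables with a continuous distribution). For $i\le n$ let $R_i^n=\#\{j\le n: X_j\le X_i\}$ be the rank of $X_i$ among $X_1,\dots,X_n$. Fix $p$ with $\tfrac12<p\le 1$ and consider the $p$-percentile rule: the first observation is retained, and for $n\ge 2$ the observation $X_n$ is retained if and only if $R_n^n\le\lceil pL_{n-1}\rceil$, where $L_n$ is the number of observations retained among the first $n$. Let $S_n\subseteq\{1,\dots,n\}$ be the set of indices of the observations retained among the first $n$ (so $L_n=|S_n|\ge 1$ for $n\ge1$), let $Q_n=\sum_{i\in S_n}R_i^n$ be the sum of the ranks of the retained observations, $A_n=Q_n/L_n$ their average rank, and $V_n=Q_n/L_n^2=A_n/L_n$. Put $$q_p=\frac{p^2}{2(2p-1)}.$$ Then $V_n\to q_p$ almost surely as $n\to\infty$. Furthermore, each $V_n$ is integrable and $E(V_n)\to q_p$. -/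

import Mathlib

open MeasureTheory Filter
open scoped Topology ENNReal Nat

namespace RankSelection

/-- The rank of the observation with index `i` among the first `n` observations
`x 0, …, x (n - 1)` (observations are indexed from `0`; small values are good). -/
noncomputable def rank (x : ℕ → ℝ) (n i : ℕ) : ℕ :=
  ((Finset.range n).filter (fun j => x j ≤ x i)).card

/-- The set of indices retained after `n` observations by the rank selection rule with threshold
function `r`: the `(n + 1)`-st observation, which is `x n`, is retained if and only if its rank
among the first `n + 1` observations is at most `r` of the number of items retained so far. -/
noncomputable def retained (r : ℕ → ℕ) (x : ℕ → ℝ) : ℕ → Finset ℕ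
  | 0 => ∅
  | n + 1 =>
    if rank x (n + 1) n ≤ r (retained r x n).card then insert n (retained r x n)
    else retained r x n

/-- The threshold function of the `p`-percentile rule: `r 0 = 1` (so that the first observation is
always retained) and `r k = ⌈p k⌉` for `k ≥ 1`. -/
noncomputable def percentile (p : ℝ) (k : ℕ) : ℕ :=
  if k = 0 then 1 else ⌈p * k⌉₊

/-- `L_n`, the number of items retained after `n` observations. -/
noncomputable def numRetained (r : ℕ → ℕ) (x : ℕ → ℝ) (n : ℕ) : ℕ :=
  (retained r x n).card

/-- `Q_n`, the sum of the ranks, among the first `n` observations, of the items retained after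
`n` observations. -/
noncomputable def rankSum (r : ℕ → ℕ) (x : ℕ → ℝ) (n : ℕ) : ℕ :=
  ∑ i ∈ retained r x n, rank x n i

/-- `A_n = Q_n / L_n`, the average rank of the retained items. -/
noncomputable def averageRank (r : ℕ → ℕ) (x : ℕ → ℝ) (n : ℕ) : ℝ :=
  (rankSum r x n : ℝ) / (numRetained r x n : ℝ)

/-- `V_n = Q_n / L_n ^ 2`. -/
noncomputable def normalizedRankSum (r : ℕ → ℕ) (x : ℕ → ℝ) (n : ℕ) : ℝ :=
  (rankSum r x n : ℝ) / (numRetained r x n : ℝ) ^ 2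

/-- For every `n`, all `n!` strict orderings of the first `n` observations have the same
probability `1 / n!` (so ties have probability zero). This holds in particular for i.i.d.
observations with a continuous distribution. -/
def OrderingsEquallyLikely {Ω : Type*} [MeasurableSpace Ω] (μ : Measure Ω)
    (X : ℕ → Ω → ℝ) : Prop :=
  ∀ (n : ℕ) (σ : Equiv.Perm (Fin n)),
    μ {ω | StrictMono (fun i : Fin n => X (σ i) ω)} = ((n ! : ℕ) : ℝ≥0∞)⁻¹

/-- At least one item is retained once there is an observation, so the quotients by `L_n` above
are genuine for `n ≥ 1`. -/
theorem numRetained_pos (p : ℝ) (x : ℕ → ℝ) (n : ℕ) :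
    0 < numRetained (percentile p) x (n + 1) := by
  unfold numRetained
  induction n with
  | zero =>
    have h : rank x (0 + 1) 0 ≤ percentile p (retained (percentile p) x 0).card := by
      simpa [rank, retained, percentile] using
        Finset.card_filter_le ({0} : Finset ℕ) (fun j => x j ≤ x 0)
    rw [retained, if_pos h]
    exact Finset.card_pos.mpr ⟨0, Finset.mem_insert_self _ _⟩
  | succ n ih =>
    rw [retained]
    split_ifs
    · exact Finset.card_pos.mpr ⟨n + 1, Finset.mem_insert_self _ _⟩
    · exact ih

end RankSelection

/-! Almost surely there are no ties, and the relative ranks at arrival are then independent, the one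
of the observation after the first `n` being uniform on `{1, …, n + 1}`. They determine the multiset
of ranks of the retained items, so everything reduces to a Markov chain driven by lists of relative
ranks.

Let `L` items be retained with rank sum `Q`, let `r = ⌈pL⌉`, and let `c k` be the number of retained
ranks that are at least `k`, so that `∑ c k = Q`. An arrival of rank `k` adds `c k` to `Q`; if `k ≤
r` it also adds `k` to `Q` and `1` to `L`. Summing the change of `V = Q / L²` over `k` gives `V -
2pV + p²/2 + O((1 + V) / L)`, whose main term is `-(2p - 1)(V - q)`: as `p > 1/2`, `V` is pulled
towards `q`.

Quantitatively, `(V - q)²` has drift at most `-2(2p - 1)(V - q)² + C(1 + (V - q)²) / L`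
(`sum_sq_le`). Since `1 / L` itself decreases in mean, adding `D / L` absorbs the error: once `L ≥
K`, the potential contracts in conditional mean by `1 - η / (n + 1)` (`sum_potential_le`). The
harmonic series diverges, so on `{L_N ≥ K}` its mean tends to `0`; being a nonnegative
supermartingale there, it also tends to `0` almost surely. These events exhaust the space because
`E(1 / L_n) → 0`.

For the means, the contribution of the complement must be small uniformly in large `n`. There `V` is
dominated by `1 + Q * weight L`, and the drift of `Q * weight L` is negative for large values and
bounded above for every `L` (`sum_weight_numOf_le`). -/

namespace RankSelection

/-! ### Encoding the selection rule by relative ranks -/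

/-- The relative ranks of the first `n` observations at their arrival, most recent first. -/
noncomputable def relRanks (x : ℕ → ℝ) : ℕ → List ℕ
  | 0 => []
  | n + 1 => rank x (n + 1) n :: relRanks x n

/-- The possible values of `relRanks x n`. -/
def rankLists : ℕ → Finset (List ℕ)
  | 0 => {[]}
  | n + 1 => (Finset.Icc 1 (n + 1) ×ˢ rankLists n).image (fun a => a.1 :: a.2)

/-- The rank of an earlier observation after the arrival of an observation of rank `k`. -/
def bump (k j : ℕ) : ℕ := if k ≤ j then j + 1 else j

/-- Update of the multiset of ranks of the retained items on arrival of an observation of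
rank `k`. -/
def rankStep (r : ℕ → ℕ) (k : ℕ) (M : Multiset ℕ) : Multiset ℕ :=
  if k ≤ r M.card then k ::ₘ M.map (bump k) else M.map (bump k)

/-- The multiset of ranks of the retained items, as a function of the relative ranks. -/
def retainedRanks (r : ℕ → ℕ) : List ℕ → Multiset ℕ
  | [] => 0
  | k :: l => rankStep r k (retainedRanks r l)

theorem cons_mem_rankLists {n k : ℕ} {l : List ℕ} :
    k :: l ∈ rankLists (n + 1) ↔ k ∈ Finset.Icc 1 (n + 1) ∧ l ∈ rankLists n := by
  simp [rankLists]

theorem sum_rankLists_succ (n : ℕ) (f : List ℕ → ℝ) :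
    ∑ l ∈ rankLists (n + 1), f l =
      ∑ l ∈ rankLists n, ∑ k ∈ Finset.Icc 1 (n + 1), f (k :: l) := by
  rw [rankLists, Finset.sum_image, Finset.sum_product_right]
  rintro ⟨a, b⟩ _ ⟨c, d⟩ _ h
  simpa using h

theorem card_rankLists (n : ℕ) : (rankLists n).card = n ! := by
  induction n with
  | zero => simp [rankLists]
  | succ n ih =>
    rw [rankLists, Finset.card_image_of_injective, Finset.card_product, ih, Nat.factorial_succ]
    · simp
    · rintro ⟨a, b⟩ ⟨c, d⟩ h
      simpa using h

theorem relRanks_mem_rankLists (x : ℕ → ℝ) (n : ℕ) : relRanks x n ∈ rankLists n := by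
  induction n with
  | zero => simp [relRanks, rankLists]
  | succ n ih =>
    refine cons_mem_rankLists.2 ⟨Finset.mem_Icc.2 ⟨?_, ?_⟩, ih⟩
    · exact Finset.card_pos.2 ⟨n, by simp⟩
    · exact (Finset.card_filter_le _ _).trans (by simp)

theorem retained_subset (r : ℕ → ℕ) (x : ℕ → ℝ) (n : ℕ) : retained r x n ⊆ Finset.range n := by
  induction n with
  | zero => simp [retained]
  | succ n ih =>
    have h : retained r x n ⊆ Finset.range (n + 1) :=
      ih.trans (Finset.range_mono (Nat.le_succ n))
    rw [retained]
    split_ifs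
    · exact Finset.insert_subset (by simp) h
    · exact h

theorem rank_succ (x : ℕ → ℝ) (n i : ℕ) :
    rank x (n + 1) i = rank x n i + if x n ≤ x i then 1 else 0 := by
  unfold rank
  rw [Finset.range_add_one, Finset.filter_insert]
  split_ifs
  · rw [Finset.card_insert_of_notMem (by simp)]
  · simp

/-- Without ties, the ranks after an arrival are determined by the ranks before it and the relative
rank of the new observation. -/
theorem rank_succ_eq_bump {x : ℕ → ℝ} {n i : ℕ} (hi : i < n) (hne : x i ≠ x n) :
    rank x (n + 1) i = bump (rank x (n + 1) n) (rank x n i) := by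
  rw [rank_succ x n i, rank_succ x n n, bump]
  rcases lt_or_gt_of_ne hne with h | h
  · have : rank x n i ≤ rank x n n :=
      Finset.card_le_card (Finset.monotone_filter_right _ fun j _ hj => hj.trans h.le)
    rw [if_neg h.not_ge, if_pos le_rfl, if_neg (by omega)]
    simp
  · have : rank x n n < rank x n i := by
      refine Finset.card_lt_card ⟨Finset.monotone_filter_right _ fun j _ hj => hj.trans h.le, ?_⟩
      intro hsub
      have hi' : i ∈ (Finset.range n).filter (fun j => x j ≤ x i) := by simp [hi]
      exact h.not_ge (Finset.mem_filter.1 (hsub hi')).2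
    rw [if_pos h.le, if_pos le_rfl, if_pos (by omega)]

theorem map_rank_retained (r : ℕ → ℕ) {x : ℕ → ℝ} (hx : Function.Injective x) (n : ℕ) :
    (retained r x n).val.map (rank x n) = retainedRanks r (relRanks x n) := by
  induction n with
  | zero => simp [retained, relRanks, retainedRanks]
  | succ n ih =>
    have hmap : (retained r x n).val.map (rank x (n + 1)) =
        ((retained r x n).val.map (rank x n)).map (bump (rank x (n + 1) n)) := by
      rw [Multiset.map_map]
      refine Multiset.map_congr rfl fun i hi => ?_
      have hin : i < n := Finset.mem_range.1 (retained_subset r x n hi)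
      exact rank_succ_eq_bump hin fun h => hin.ne (hx h)
    have hcard : (retained r x n).card = (retainedRanks r (relRanks x n)).card := by
      rw [← ih, Multiset.card_map]; rfl
    have hn : n ∉ retained r x n := fun h => by simpa using retained_subset r x n h
    rw [retained, relRanks, retainedRanks, rankStep, ← hcard]
    split_ifs
    · rw [Finset.insert_val_of_notMem hn, Multiset.map_cons, hmap, ih]
    · rw [hmap, ih]

theorem numRetained_eq (r : ℕ → ℕ) {x : ℕ → ℝ} (hx : Function.Injective x) (n : ℕ) :
    numRetained r x n = (retainedRanks r (relRanks x n)).card := by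
  rw [← map_rank_retained r hx, Multiset.card_map]; rfl

theorem rankSum_eq (r : ℕ → ℕ) {x : ℕ → ℝ} (hx : Function.Injective x) (n : ℕ) :
    rankSum r x n = (retainedRanks r (relRanks x n)).sum := by
  rw [← map_rank_retained r hx]; rfl

/-! ### The relative ranks determine the ordering -/

theorem rank_eq_of_relRanks_eq {n : ℕ} {x y : ℕ → ℝ} (hx : Set.InjOn x (Set.Iio n))
    (hy : Set.InjOn y (Set.Iio n)) (h : relRanks x n = relRanks y n) :
    ∀ i < n, rank x n i = rank y n i := by
  induction n with
  | zero => simp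
  | succ n ih =>
    simp only [relRanks, List.cons.injEq] at h
    intro i hi
    have hsub : Set.Iio n ⊆ Set.Iio (n + 1) := Set.Iio_subset_Iio (Nat.le_succ n)
    rcases (Nat.lt_succ_iff_lt_or_eq.1 hi) with hin | rfl
    · rw [rank_succ_eq_bump hin, rank_succ_eq_bump hin, h.1,
        ih (hx.mono hsub) (hy.mono hsub) h.2 i hin]
      · exact fun e => hin.ne (hy hi (Set.mem_Iio.2 (Nat.lt_succ_self n)) e)
      · exact fun e => hin.ne (hx hi (Set.mem_Iio.2 (Nat.lt_succ_self n)) e)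
    · exact h.1

theorem rank_of_strictMono {n : ℕ} {x : ℕ → ℝ} {σ : Equiv.Perm (Fin n)}
    (h : StrictMono fun i : Fin n => x (σ i)) (i : Fin n) : rank x n (σ i) = i + 1 := by
  have hset : (Finset.range n).filter (fun j => x j ≤ x (σ i)) =
      (Finset.Iic i).map (σ.toEmbedding.trans Fin.valEmbedding) := by
    ext j
    simp only [Finset.mem_filter, Finset.mem_range, Finset.mem_map, Finset.mem_Iic,
      Function.Embedding.trans_apply, Equiv.coe_toEmbedding, Fin.valEmbedding_apply]
    constructor
    · rintro ⟨hj, hle⟩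
      refine ⟨σ.symm ⟨j, hj⟩, ?_, by simp⟩
      rw [← h.le_iff_le]
      simpa using hle
    · rintro ⟨a, ha, rfl⟩
      exact ⟨(σ a).2, h.monotone ha⟩
  rw [rank, hset, Finset.card_map, Fin.card_Iic]

theorem injOn_of_strictMono {n : ℕ} {x : ℕ → ℝ} {σ : Equiv.Perm (Fin n)}
    (h : StrictMono fun i : Fin n => x (σ i)) : Set.InjOn x (Set.Iio n) := by
  intro a ha b hb hab
  have := h.injective (a₁ := σ.symm ⟨a, ha⟩) (a₂ := σ.symm ⟨b, hb⟩) (by simpa using hab)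
  simpa [Fin.ext_iff] using this

/-- Relative ranks determine final ranks, and the final rank of observation `σ i` is `i + 1`, so the
sorting permutation can be read off. -/
theorem perm_eq_of_relRanks_eq {n : ℕ} {x y : ℕ → ℝ} {σ τ : Equiv.Perm (Fin n)}
    (hx : StrictMono fun i : Fin n => x (σ i)) (hy : StrictMono fun i : Fin n => y (τ i))
    (h : relRanks x n = relRanks y n) : σ = τ := by
  ext i
  have h1 := rank_eq_of_relRanks_eq (injOn_of_strictMono hx) (injOn_of_strictMono hy) h
    (σ i) (σ i).2
  have h2 := rank_of_strictMono hy (τ.symm (σ i))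
  rw [rank_of_strictMono hx, ← Equiv.apply_symm_apply τ (σ i), h2] at h1
  have h3 : i = τ.symm (σ i) := Fin.ext (by omega)
  rw [congrArg τ h3, Equiv.apply_symm_apply]

theorem relRanks_congr {n : ℕ} {x y : ℕ → ℝ}
    (h : ∀ i < n, ∀ j < n, x i ≤ x j ↔ y i ≤ y j) : relRanks x n = relRanks y n := by
  induction n with
  | zero => rfl
  | succ n ih =>
    rw [relRanks, relRanks, ih fun i hi j hj => h i (hi.trans n.lt_succ_self) j
      (hj.trans n.lt_succ_self)]
    refine congrArg₂ List.cons (congrArg Finset.card ?_) rfl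
    exact Finset.filter_congr fun j hj => h j (Finset.mem_range.1 hj) n n.lt_succ_self

theorem relRanks_eq_of_strictMono {n : ℕ} {x y : ℕ → ℝ} {σ : Equiv.Perm (Fin n)}
    (hx : StrictMono fun i : Fin n => x (σ i)) (hy : StrictMono fun i : Fin n => y (σ i)) :
    relRanks x n = relRanks y n := by
  refine relRanks_congr fun i hi j hj => ?_
  have h1 := hx.le_iff_le (a := σ.symm ⟨i, hi⟩) (b := σ.symm ⟨j, hj⟩)
  have h2 := hy.le_iff_le (a := σ.symm ⟨i, hi⟩) (b := σ.symm ⟨j, hj⟩)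
  simp only [Equiv.apply_symm_apply] at h1 h2
  exact h1.trans h2.symm

/-! ### Invariants of the multiset of retained ranks -/

theorem card_rankStep (r : ℕ → ℕ) (k : ℕ) (M : Multiset ℕ) :
    (rankStep r k M).card = if k ≤ r M.card then M.card + 1 else M.card := by
  unfold rankStep
  split_ifs <;> simp

theorem sum_map_bump (k : ℕ) (M : Multiset ℕ) :
    (M.map (bump k)).sum = M.sum + M.countP (k ≤ ·) := by
  induction M using Multiset.induction with
  | empty => simp
  | cons a M ih =>
    rw [Multiset.map_cons, Multiset.sum_cons, Multiset.sum_cons, ih, bump, Multiset.countP_cons]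
    split_ifs <;> omega

theorem sum_rankStep (r : ℕ → ℕ) (k : ℕ) (M : Multiset ℕ) :
    (rankStep r k M).sum =
      if k ≤ r M.card then M.sum + (M.countP (k ≤ ·) + k) else M.sum + M.countP (k ≤ ·) := by
  unfold rankStep
  split_ifs
  · rw [Multiset.sum_cons, sum_map_bump]; omega
  · rw [sum_map_bump]

/-- Double counting: an item of rank `a` is counted once for each `k = 1, …, a`. This makes the
total displacement over all possible arrivals equal to the rank sum. -/
theorem sum_countP_le {n : ℕ} (M : Multiset ℕ) (hM : ∀ j ∈ M, j ≤ n) :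
    ∑ k ∈ Finset.Icc 1 n, M.countP (k ≤ ·) = M.sum := by
  induction M using Multiset.induction with
  | empty => simp
  | cons a M ih =>
    have ha : a ≤ n := hM a (by simp)
    have hf : (Finset.Icc 1 n).filter (fun k => k ≤ a) = Finset.Icc 1 a := by
      ext k; simp only [Finset.mem_filter, Finset.mem_Icc]; omega
    simp only [Multiset.countP_cons, Finset.sum_add_distrib, Multiset.sum_cons]
    rw [ih fun j hj => hM j (by simp [hj]), ← Finset.card_filter, hf]
    simp [add_comm]

theorem card_le_card_cons (r : ℕ → ℕ) (k : ℕ) (l : List ℕ) :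
    (retainedRanks r l).card ≤ (retainedRanks r (k :: l)).card := by
  rw [retainedRanks, card_rankStep]
  split_ifs <;> omega

theorem card_retainedRanks_le (r : ℕ → ℕ) {n : ℕ} {l : List ℕ} (hl : l ∈ rankLists n) :
    (retainedRanks r l).card ≤ n := by
  induction n generalizing l with
  | zero => simp_all [rankLists, retainedRanks]
  | succ n ih =>
    cases l with
    | nil => simp [retainedRanks]
    | cons k l =>
      have := ih (cons_mem_rankLists.1 hl).2
      rw [retainedRanks, card_rankStep]
      split_ifs <;> omega

theorem le_of_mem_retainedRanks (r : ℕ → ℕ) {n : ℕ} {l : List ℕ} (hl : l ∈ rankLists n) :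
    ∀ j ∈ retainedRanks r l, j ≤ n := by
  induction n generalizing l with
  | zero => simp_all [rankLists, retainedRanks]
  | succ n ih =>
    cases l with
    | nil => simp [retainedRanks]
    | cons k l =>
      have hk := Finset.mem_Icc.1 (cons_mem_rankLists.1 hl).1
      have hb : ∀ j ∈ (retainedRanks r l).map (bump k), j ≤ n + 1 := by
        intro j hj
        obtain ⟨i, hi, rfl⟩ := Multiset.mem_map.1 hj
        have := ih (cons_mem_rankLists.1 hl).2 i hi
        rw [bump]; split_ifs <;> omega
      intro j hj
      rw [retainedRanks, rankStep] at hj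
      split_ifs at hj
      · rcases Multiset.mem_cons.1 hj with rfl | hj
        · exact hk.2
        · exact hb j hj
      · exact hb j hj

theorem card_retainedRanks_pos (p : ℝ) {n : ℕ} {l : List ℕ} (hl : l ∈ rankLists (n + 1)) :
    0 < (retainedRanks (percentile p) l).card := by
  induction n generalizing l with
  | zero =>
    cases l with
    | nil => simp [rankLists] at hl
    | cons k l =>
      have hk := cons_mem_rankLists.1 hl
      have : l = [] := by simpa [rankLists] using hk.2
      subst this
      have := Finset.mem_Icc.1 hk.1
      rw [retainedRanks, card_rankStep, if_pos] <;> simp [retainedRanks, percentile]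
      omega
  | succ n ih =>
    cases l with
    | nil => simp [rankLists] at hl
    | cons k l => exact (ih (cons_mem_rankLists.1 hl).2).trans_le (card_le_card_cons _ k l)

theorem percentile_one {p : ℝ} (hp0 : 0 < p) (hp1 : p ≤ 1) : percentile p 1 = 1 := by
  have : ⌈p⌉₊ = 1 := (Nat.ceil_eq_iff one_ne_zero).2 ⟨by simpa using hp0, by simpa using hp1⟩
  simp [percentile, this]

/-- If only one item is retained, it is the best one. -/
theorem sum_eq_one_of_card_eq_one {p : ℝ} (hp0 : 0 < p) (hp1 : p ≤ 1) {n : ℕ} {l : List ℕ}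
    (hl : l ∈ rankLists n) (h : (retainedRanks (percentile p) l).card = 1) :
    (retainedRanks (percentile p) l).sum = 1 := by
  induction n generalizing l with
  | zero => simp_all [rankLists, retainedRanks]
  | succ n ih =>
    cases l with
    | nil => simp [rankLists] at hl
    | cons k l =>
      obtain ⟨hk, hl'⟩ := cons_mem_rankLists.1 hl
      rw [retainedRanks, card_rankStep] at h
      rw [retainedRanks, sum_rankStep]
      split_ifs at h ⊢ with hr
      · have h0 : (retainedRanks (percentile p) l).card = 0 := by omega
        have hn : n = 0 := by
          rcases n with _ | n
          · rfl
          · have := card_retainedRanks_pos p hl'; omega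
        subst hn
        rw [Multiset.card_eq_zero] at h0
        simp only [Finset.mem_Icc] at hk
        simp [h0]; omega
      · have hs := ih hl' h
        rw [h, percentile_one hp0 hp1] at hr
        obtain ⟨a, ha⟩ := Multiset.card_eq_one.1 h
        rw [ha, Multiset.sum_singleton] at hs
        subst hs
        -- A rejected arrival has rank at least `2` here, so it does not displace the single
        -- retained item.
        rw [ha, ← Multiset.cons_zero, Multiset.countP_cons, if_neg (by omega)]
        simp

/-! ### The law of the relative ranks -/

section Law

variable {Ω : Type*} [MeasurableSpace Ω] {μ : Measure Ω} {X : ℕ → Ω → ℝ}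

theorem measurable_rank (hX : ∀ i, Measurable (X i)) (n i : ℕ) :
    Measurable fun ω => rank (fun j => X j ω) n i := by
  simp only [rank, Finset.card_filter]
  exact Finset.measurable_fun_sum _ fun j _ =>
    Measurable.ite (measurableSet_le (hX j) (hX i)) measurable_const measurable_const

theorem measurable_relRanks (hX : ∀ i, Measurable (X i)) (n : ℕ) :
    Measurable[_, ⊤] fun ω => relRanks (fun j => X j ω) n := by
  let _ : MeasurableSpace (List ℕ) := ⊤
  induction n with
  | zero => exact measurable_const
  | succ n ih =>
    have h : Measurable fun a : ℕ × List ℕ => a.1 :: a.2 := measurable_of_countable _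
    exact h.comp ((measurable_rank hX (n + 1) n).prodMk ih)

/-- The natural filtration of the relative ranks. -/
noncomputable def rankFiltration (hX : ∀ i, Measurable (X i)) : Filtration ℕ ‹MeasurableSpace Ω› where
  seq n := MeasurableSpace.comap (fun ω => relRanks (fun j => X j ω) n) ⊤
  mono' := by
    refine monotone_nat_of_le_succ fun n => ?_
    rintro s ⟨B, -, rfl⟩
    exact ⟨List.tail ⁻¹' B, trivial, rfl⟩
  le' n := (measurable_relRanks hX n).comap_le

theorem measurable_rankFiltration (hX : ∀ i, Measurable (X i)) {n : ℕ} {β : Type*}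
    [MeasurableSpace β] (f : List ℕ → β) :
    Measurable[rankFiltration hX n] fun ω => f (relRanks (fun j => X j ω) n) := by
  intro s _
  exact ⟨f ⁻¹' s, trivial, rfl⟩

theorem measurable_comp_relRanks (hX : ∀ i, Measurable (X i)) {n : ℕ} {β : Type*}
    [MeasurableSpace β] (f : List ℕ → β) :
    Measurable fun ω => f (relRanks (fun j => X j ω) n) :=
  (measurable_rankFiltration hX f).mono ((rankFiltration hX).le n) le_rfl

theorem measurableSet_strictMono (hX : ∀ i, Measurable (X i)) {n : ℕ} (σ : Equiv.Perm (Fin n)) :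
    MeasurableSet {ω | StrictMono fun i : Fin n => X (σ i) ω} := by
  simp only [StrictMono, Set.ofPred_forall]
  exact .iInter fun a => .iInter fun b => .iInter fun _ => measurableSet_lt (hX _) (hX _)

/-- The `n!` ordering events are disjoint and each has probability `1 / n!`, so they fill the space.
-/
theorem ae_exists_strictMono [IsProbabilityMeasure μ] (hX : ∀ i, Measurable (X i))
    (hord : OrderingsEquallyLikely μ X) (n : ℕ) :
    ∀ᵐ ω ∂μ, ∃ σ : Equiv.Perm (Fin n), StrictMono fun i : Fin n => X (σ i) ω := by
  have hU : {ω | ∃ σ : Equiv.Perm (Fin n), StrictMono fun i : Fin n => X (σ i) ω} =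
      ⋃ σ : Equiv.Perm (Fin n), {ω | StrictMono fun i : Fin n => X (σ i) ω} := by
    ext; simp
  refine (prob_compl_eq_zero_iff (hU ▸ .iUnion fun σ => measurableSet_strictMono hX σ)).2 ?_
  rw [hU, measure_iUnion _ fun σ => measurableSet_strictMono hX σ, tsum_fintype,
    Finset.sum_congr rfl fun σ _ => hord n σ]
  · rw [Finset.sum_const, Finset.card_univ, Fintype.card_perm, Fintype.card_fin, nsmul_eq_mul,
      ENNReal.mul_inv_cancel (by simp [Nat.factorial_ne_zero]) (ENNReal.natCast_ne_top _)]
  · intro σ τ hne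
    refine Set.disjoint_left.2 fun ω h1 h2 => hne ?_
    exact perm_eq_of_relRanks_eq (x := fun j => X j ω) (y := fun j => X j ω) h1 h2 rfl

theorem ae_injective [IsProbabilityMeasure μ] (hX : ∀ i, Measurable (X i))
    (hord : OrderingsEquallyLikely μ X) :
    ∀ᵐ ω ∂μ, Function.Injective fun i => X i ω := by
  filter_upwards [ae_all_iff.2 (ae_exists_strictMono hX hord)] with ω h i j hij
  obtain ⟨σ, hσ⟩ := h (max i j + 1)
  exact injOn_of_strictMono (x := fun i => X i ω) hσ (Set.mem_Iio.2 (by omega))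
    (Set.mem_Iio.2 (by omega)) hij

theorem exists_bound (n : ℕ) (f : List ℕ → ℝ) :
    ∃ C, ∀ x : ℕ → ℝ, ‖f (relRanks x n)‖ ≤ C :=
  ⟨∑ l ∈ rankLists n, ‖f l‖, fun _ =>
    Finset.single_le_sum (f := fun l => ‖f l‖) (fun _ _ => norm_nonneg _)
      (relRanks_mem_rankLists _ n)⟩

theorem integrable_comp_relRanks [IsFiniteMeasure μ] (hX : ∀ i, Measurable (X i)) (n : ℕ)
    (f : List ℕ → ℝ) : Integrable (fun ω => f (relRanks (fun j => X j ω) n)) μ := by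
  obtain ⟨C, hC⟩ := exists_bound n f
  exact .of_bound (measurable_comp_relRanks hX f).aestronglyMeasurable C (ae_of_all _ fun _ => hC _)

/-- A representative of the observations ordered by `σ`. -/
noncomputable def permSeq {n : ℕ} (σ : Equiv.Perm (Fin n)) (i : ℕ) : ℝ :=
  if h : i < n then ((σ.symm ⟨i, h⟩ : ℕ) : ℝ) else 0

theorem strictMono_permSeq {n : ℕ} (σ : Equiv.Perm (Fin n)) :
    StrictMono fun i : Fin n => permSeq σ (σ i) := by
  intro a b h
  simpa [permSeq] using h

/-- An injection from the `n!` permutations into a set of `n!` lists is onto. -/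
theorem image_relRanks_permSeq (n : ℕ) :
    Finset.univ.image (fun σ : Equiv.Perm (Fin n) => relRanks (permSeq σ) n) = rankLists n := by
  refine Finset.eq_of_subset_of_card_le ?_ ?_
  · intro l hl
    obtain ⟨σ, -, rfl⟩ := Finset.mem_image.1 hl
    exact relRanks_mem_rankLists _ n
  · rw [Finset.card_image_of_injective, card_rankLists, Finset.card_univ, Fintype.card_perm,
      Fintype.card_fin]
    intro σ τ h
    exact perm_eq_of_relRanks_eq (strictMono_permSeq σ) (strictMono_permSeq τ) h

/-- The relative ranks are uniformly distributed on `rankLists n`. -/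
theorem integral_comp_relRanks [IsProbabilityMeasure μ] (hX : ∀ i, Measurable (X i))
    (hord : OrderingsEquallyLikely μ X) (n : ℕ) (f : List ℕ → ℝ) :
    ∫ ω, f (relRanks (fun j => X j ω) n) ∂μ = ((n ! : ℕ) : ℝ)⁻¹ * ∑ l ∈ rankLists n, f l := by
  have hae : (fun ω => f (relRanks (fun j => X j ω) n)) =ᵐ[μ] fun ω =>
      ∑ σ : Equiv.Perm (Fin n), {ω | StrictMono fun i : Fin n => X (σ i) ω}.indicator
        (fun _ => f (relRanks (permSeq σ) n)) ω := by
    filter_upwards [ae_exists_strictMono hX hord n] with ω ⟨σ, hσ⟩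
    rw [Finset.sum_eq_single σ]
    · rw [Set.indicator_of_mem (by exact hσ)]
      rw [relRanks_eq_of_strictMono (x := fun j => X j ω) hσ (strictMono_permSeq σ)]
    · intro τ _ hne
      exact Set.indicator_of_notMem
        (fun h => hne (perm_eq_of_relRanks_eq (x := fun j => X j ω) (y := fun j => X j ω) h hσ rfl)) _
    · simp
  rw [integral_congr_ae hae, integral_finsetSum]
  · rw [← image_relRanks_permSeq, Finset.sum_image, Finset.mul_sum]
    · refine Finset.sum_congr rfl fun σ _ => ?_
      rw [integral_indicator_const _ (measurableSet_strictMono hX σ), smul_eq_mul, Measure.real,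
        hord n σ, ENNReal.toReal_inv, ENNReal.toReal_natCast]
    · intro σ _ τ _ h
      exact perm_eq_of_relRanks_eq (strictMono_permSeq σ) (strictMono_permSeq τ) h
  · exact fun σ _ => (integrable_const _).indicator (measurableSet_strictMono hX σ)

/-- Given the past, the next relative rank is uniformly distributed on `{1, …, n + 1}`. -/
theorem setIntegral_succ_le [IsProbabilityMeasure μ] (hX : ∀ i, Measurable (X i))
    (hord : OrderingsEquallyLikely μ X) {n : ℕ} {f g : List ℕ → ℝ}
    {P : List ℕ → Prop} (h : ∀ l ∈ rankLists n, P l → ∑ k ∈ Finset.Icc 1 (n + 1), f (k :: l) ≤ (n + 1 : ℝ) * g l)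
    {s : Set Ω} (hs : MeasurableSet[rankFiltration hX n] s)
    (hP : ∀ ω ∈ s, P (relRanks (fun j => X j ω) n)) :
    ∫ ω in s, f (relRanks (fun j => X j ω) (n + 1)) ∂μ ≤
      ∫ ω in s, g (relRanks (fun j => X j ω) n) ∂μ := by
  have hs' := (rankFiltration hX).le n s hs
  obtain ⟨B, hBP, rfl⟩ : ∃ B : Set (List ℕ), (∀ l ∈ B, P l) ∧
      (fun ω => relRanks (fun j => X j ω) n) ⁻¹' B = s := by
    obtain ⟨B, -, rfl⟩ := hs
    refine ⟨B ∩ {l | P l}, fun l hl => hl.2, ?_⟩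
    ext ω
    exact ⟨fun h => h.1, fun h => ⟨h, hP ω h⟩⟩
  rw [← integral_indicator hs', ← integral_indicator hs']
  -- Both integrals become uniform averages over lists; `(n + 1)! = (n + 1) * n!` reduces the claim
  -- to the hypothesis on each list in `B`.
  have h1 := integral_comp_relRanks hX hord (n + 1) fun l => (List.tail ⁻¹' B).indicator f l
  have h2 := integral_comp_relRanks hX hord n fun l => B.indicator g l
  have e1 : (fun ω => ((fun ω => relRanks (fun j => X j ω) n) ⁻¹' B).indicator
      (fun ω => f (relRanks (fun j => X j ω) (n + 1))) ω) = fun ω =>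
      (List.tail ⁻¹' B).indicator f (relRanks (fun j => X j ω) (n + 1)) := by
    ext ω; rfl
  have e2 : (fun ω => ((fun ω => relRanks (fun j => X j ω) n) ⁻¹' B).indicator
      (fun ω => g (relRanks (fun j => X j ω) n)) ω) = fun ω =>
      B.indicator g (relRanks (fun j => X j ω) n) := by
    ext ω; rfl
  rw [e1, e2, h1, h2, sum_rankLists_succ, Nat.factorial_succ]
  push_cast
  rw [mul_inv, mul_comm ((n : ℝ) + 1)⁻¹, mul_assoc]
  refine mul_le_mul_of_nonneg_left ?_ (by positivity)
  rw [inv_mul_le_iff₀ (by positivity), Finset.mul_sum]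
  refine Finset.sum_le_sum fun l hl => ?_
  by_cases hB : l ∈ B
  · simpa [Set.indicator, hB] using h l hl (hBP l hB)
  · simp [Set.indicator, hB]

end Law

/-! ### One-step drifts -/

theorem sum_Icc_split {r N : ℕ} (hr : r ≤ N) (f : ℕ → ℝ) :
    ∑ k ∈ Finset.Icc 1 N, f k = ∑ k ∈ Finset.Icc 1 r, f k + ∑ k ∈ Finset.Ioc r N, f k := by
  rw [← Finset.sum_union]
  · congr 1; ext k; simp only [Finset.mem_union, Finset.mem_Icc, Finset.mem_Ioc]; omega
  · refine Finset.disjoint_left.2 fun k => ?_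
    simp only [Finset.mem_Icc, Finset.mem_Ioc]; omega

theorem sum_rankStep_eq (r : ℕ → ℕ) {N : ℕ} (M : Multiset ℕ) (hr : r M.card ≤ N)
    (G : ℕ → ℕ → ℝ) :
    ∑ k ∈ Finset.Icc 1 N, G (rankStep r k M).card (rankStep r k M).sum =
      ∑ k ∈ Finset.Icc 1 (r M.card), G (M.card + 1) (M.sum + (M.countP (k ≤ ·) + k)) +
        ∑ k ∈ Finset.Ioc (r M.card) N, G M.card (M.sum + M.countP (k ≤ ·)) := by
  rw [sum_Icc_split hr]
  congr 1 <;> refine Finset.sum_congr rfl fun k hk => ?_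
  · have := (Finset.mem_Icc.1 hk).2
    rw [card_rankStep, sum_rankStep, if_pos this, if_pos this]
  · have := (Finset.mem_Ioc.1 hk).1.not_ge
    rw [card_rankStep, sum_rankStep, if_neg this, if_neg this]

theorem sum_Icc_id (r : ℕ) : ∑ k ∈ Finset.Icc 1 r, (k : ℝ) = r * (r + 1) / 2 := by
  induction r with
  | zero => simp
  | succ r ih => rw [Finset.sum_Icc_succ_top (by omega), ih]; push_cast; ring

theorem abs_drift_coeff_sub_le {p L r : ℝ} (hp : 1 / 2 < p) (hp1 : p ≤ 1) (hL : 1 ≤ L)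
    (hr1 : p * L ≤ r) (hr2 : r ≤ p * L + 1) :
    |r * (2 * L + 1) / (L + 1) ^ 2 - 2 * p| ≤ 5 / L := by
  have hL0 : 0 < L := by linarith
  rw [div_sub' (by positivity), abs_div, abs_of_pos (by positivity : 0 < (L + 1) ^ 2),
    div_le_div_iff₀ (by positivity) hL0]
  have h1 := mul_le_mul_of_nonneg_right hr1 (by linarith : 0 ≤ 2 * L + 1)
  have h2 := mul_le_mul_of_nonneg_right hr2 (by linarith : 0 ≤ 2 * L + 1)
  have h3 : p * L ≤ L := by nlinarith
  have h4 : 0 ≤ p * L := by positivity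
  have : |r * (2 * L + 1) - (L + 1) ^ 2 * (2 * p)| ≤ 3 * L + 2 := by
    rw [abs_le]; constructor <;> linarith
  have h5 := mul_le_mul_of_nonneg_right this hL0.le
  linarith [sq_nonneg L]

theorem abs_triangular_sub_le {p L r : ℝ} (hp : 1 / 2 < p) (hp1 : p ≤ 1) (hL : 1 ≤ L)
    (hr1 : p * L ≤ r) (hr2 : r ≤ p * L + 1) (hrL : r ≤ L) :
    |r * (r + 1) / 2 / (L + 1) ^ 2 - p ^ 2 / 2| ≤ 2 / L := by
  have hL0 : 0 < L := by linarith
  have hpL : 0 ≤ p * L := by positivity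
  rw [div_sub' (by positivity), abs_div, abs_of_pos (by positivity : 0 < (L + 1) ^ 2),
    div_le_div_iff₀ (by positivity) hL0]
  have h1 : (p * L) ^ 2 ≤ r ^ 2 := pow_le_pow_left₀ hpL hr1 2
  have h2 : r ^ 2 ≤ (p * L + 1) ^ 2 := pow_le_pow_left₀ (hpL.trans hr1) hr2 2
  have h3 : p ^ 2 ≤ 1 := by nlinarith
  have h4 : p * L ≤ L := by nlinarith
  have h5 : p ^ 2 * L ≤ L := by nlinarith
  have h6 : 0 ≤ p ^ 2 * L := by positivity
  have : |r * (r + 1) / 2 - (L + 1) ^ 2 * (p ^ 2 / 2)| ≤ 2 * L := by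
    rw [abs_le]; constructor <;> linarith [sq_nonneg p]
  have h7 := mul_le_mul_of_nonneg_right this hL0.le
  linarith

/-- Each accepted arrival moves `V` by at most `(2 + 3V) / L`; there are `r ≤ L` of them, so the
squared moves add up to `O(1 / L)`. -/
theorem sum_sq_retained_le {q L V W T : ℝ} {r : ℕ} {c : ℕ → ℝ} (hL : 1 ≤ L) (hrL : r ≤ L)
    (hV0 : 0 ≤ V) (hW : W = V - q) (hc0 : ∀ k, 0 ≤ c k) (hcL : ∀ k, c k ≤ L)
    (hT : T = ∑ k ∈ Finset.Icc 1 r, c k) :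
    ∑ k ∈ Finset.Icc 1 r, ((V * L ^ 2 + (c k + k)) / (L + 1) ^ 2 - q) ^ 2 ≤
      r * W ^ 2 + 2 * W * ((T + r * (r + 1) / 2 - r * V * (2 * L + 1)) / (L + 1) ^ 2) +
        (2 + 3 * V) ^ 2 / L := by
  have hL0 : 0 < L := by linarith
  have h : ∀ k ∈ Finset.Icc 1 r, ((V * L ^ 2 + (c k + k)) / (L + 1) ^ 2 - q) ^ 2 ≤
      W ^ 2 + 2 * W * ((c k + k - V * (2 * L + 1)) / (L + 1) ^ 2) +
        ((2 + 3 * V) / L) ^ 2 := by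
    intro k hk
    have hk1 : (k : ℝ) ≤ L := le_trans (by exact_mod_cast (Finset.mem_Icc.1 hk).2) hrL
    have e : (V * L ^ 2 + (c k + k)) / (L + 1) ^ 2 - q =
        W + (c k + k - V * (2 * L + 1)) / (L + 1) ^ 2 := by
      rw [hW]; field_simp; ring
    have hab : |(c k + k - V * (2 * L + 1)) / (L + 1) ^ 2| ≤ (2 + 3 * V) / L := by
      rw [abs_div, abs_of_pos (by positivity : 0 < (L + 1) ^ 2),
        div_le_div_iff₀ (by positivity) hL0]
      have h1 : |c k + k - V * (2 * L + 1)| ≤ (2 + 3 * V) * L := by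
        rw [abs_le]
        have := hc0 k; have := hcL k; have : (0 : ℝ) ≤ k := Nat.cast_nonneg k
        constructor <;> nlinarith [mul_nonneg hV0 hL0.le, mul_nonneg hV0 (sub_nonneg.2 hL)]
      have h2 : 0 ≤ (2 + 3 * V) * (2 * L + 1) := by positivity
      linarith [mul_le_mul_of_nonneg_right h1 hL0.le]
    have := sq_le_sq' (abs_le.1 hab).1 (abs_le.1 hab).2
    rw [e, add_sq]; linarith
  refine (Finset.sum_le_sum h).trans (le_of_eq_of_le ?_
    (add_le_add_right (?_ : r * ((2 + 3 * V) / L) ^ 2 ≤ _) _))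
  · rw [Finset.sum_add_distrib, Finset.sum_add_distrib, ← Finset.mul_sum, ← Finset.sum_div,
      Finset.sum_sub_distrib, Finset.sum_add_distrib, ← hT, sum_Icc_id]
    simp only [Finset.sum_const, Nat.card_Icc, nsmul_eq_mul, Nat.add_sub_cancel]
    ring
  · rw [div_pow, ← mul_div_assoc, div_le_div_iff₀ (by positivity) hL0]
    linarith [mul_le_mul_of_nonneg_right hrL (by positivity : 0 ≤ (2 + 3 * V) ^ 2 * L)]

/-- The number of rejected ranks is not controlled by `L`, so a uniform bound on the moves `c k /
L²` would be useless. Keeping one factor `c k` in the square and using `∑ c k ≤ Q` gives `V / L`. -/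
theorem sum_sq_rejected_le {q L V W T : ℝ} {r N : ℕ} {c : ℕ → ℝ} (hL : 1 ≤ L) (hrN : r ≤ N)
    (hW : W = V - q) (hT0 : 0 ≤ T) (hc0 : ∀ k, 0 ≤ c k) (hcL : ∀ k, c k ≤ L)
    (hT : ∑ k ∈ Finset.Ioc r N, c k = V * L ^ 2 - T) :
    ∑ k ∈ Finset.Ioc r N, ((V * L ^ 2 + c k) / L ^ 2 - q) ^ 2 ≤
      (N - r) * W ^ 2 + 2 * W * ((V * L ^ 2 - T) / L ^ 2) + V / L := by
  have hL0 : 0 < L := by linarith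
  have h : ∀ k ∈ Finset.Ioc r N, ((V * L ^ 2 + c k) / L ^ 2 - q) ^ 2 ≤
      W ^ 2 + 2 * W * (c k / L ^ 2) + c k / L ^ 3 := by
    intro k _
    have e : (V * L ^ 2 + c k) / L ^ 2 - q = W + c k / L ^ 2 := by rw [hW]; field_simp; ring
    have : (c k / L ^ 2) ^ 2 ≤ c k / L ^ 3 := by
      rw [div_pow, div_le_div_iff₀ (by positivity) (by positivity)]
      linarith [mul_le_mul_of_nonneg_right (hcL k)
        (mul_nonneg (hc0 k) (by positivity : 0 ≤ L ^ 3))]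
    rw [e, add_sq]; linarith
  refine (Finset.sum_le_sum h).trans (le_of_eq_of_le ?_
    (add_le_add_right (?_ : (V * L ^ 2 - T) / L ^ 3 ≤ _) _))
  · rw [Finset.sum_add_distrib, Finset.sum_add_distrib, ← Finset.mul_sum, ← Finset.sum_div,
      ← Finset.sum_div, hT]
    simp only [Finset.sum_const, Nat.card_Ioc, nsmul_eq_mul]
    rw [Nat.cast_sub hrN]
  · rw [div_le_div_iff₀ (by positivity) hL0]
    linarith [mul_nonneg hT0 hL0.le]

/-- The first moment of the change of `V` is close to that of the limiting linear drift. -/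
theorem abs_drift_add_le {p q L V W T r : ℝ} (hp : 1 / 2 < p) (hp1 : p ≤ 1)
    (hq : q * (2 * p - 1) = p ^ 2 / 2) (hL : 1 ≤ L) (hr1 : p * L ≤ r)
    (hr2 : r ≤ p * L + 1) (hrL : r ≤ L) (hV0 : 0 ≤ V) (hW : W = V - q) (hT0 : 0 ≤ T)
    (hTL : T ≤ L ^ 2) :
    |(T + r * (r + 1) / 2 - r * V * (2 * L + 1)) / (L + 1) ^ 2 + (V * L ^ 2 - T) / L ^ 2 +
      (2 * p - 1) * W| ≤ 5 * (V + 1) / L := by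
  have hL0 : 0 < L := by linarith
  have hA := abs_drift_coeff_sub_le hp hp1 hL hr1 hr2
  have hB := abs_triangular_sub_le hp hp1 hL hr1 hr2 hrL
  -- `T` enters with the factors `1 / (L + 1)²` and `-1 / L²`; only their difference survives, and
  -- `T ≤ L²` makes it `O(1 / L)`.
  have hG : |T * ((2 * L + 1) / (L ^ 2 * (L + 1) ^ 2))| ≤ 3 / L := by
    rw [abs_of_nonneg (by positivity), ← mul_div_assoc, div_le_div_iff₀ (by positivity) hL0]
    have h2 : T * ((2 * L + 1) * L) ≤ L ^ 2 * ((2 * L + 1) * L) :=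
      mul_le_mul_of_nonneg_right hTL (by positivity)
    have h3 : L ^ 2 * ((2 * L + 1) * L) ≤ L ^ 2 * (3 * (L + 1) ^ 2) :=
      mul_le_mul_of_nonneg_left (by nlinarith) (by positivity)
    linarith
  have e : (T + r * (r + 1) / 2 - r * V * (2 * L + 1)) / (L + 1) ^ 2 + (V * L ^ 2 - T) / L ^ 2 +
      (2 * p - 1) * W = -(V * (r * (2 * L + 1) / (L + 1) ^ 2 - 2 * p)) +
        (r * (r + 1) / 2 / (L + 1) ^ 2 - p ^ 2 / 2) -
          T * ((2 * L + 1) / (L ^ 2 * (L + 1) ^ 2)) := by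
    have e1 : (V * L ^ 2 - T) / L ^ 2 = V - T / L ^ 2 := by field_simp
    have e2 : T * ((2 * L + 1) / (L ^ 2 * (L + 1) ^ 2)) = T / L ^ 2 - T / (L + 1) ^ 2 := by
      field_simp; ring
    rw [e1, e2, hW, ← hq]; ring
  rw [e]
  have hA' := mul_le_mul_of_nonneg_left hA hV0
  rw [← abs_of_nonneg hV0, ← abs_mul, abs_of_nonneg hV0] at hA'
  have hA2 := abs_le.1 hA'
  have hB2 := abs_le.1 hB
  have hG2 := abs_le.1 hG
  have e3 : 5 * (V + 1) / L = V * (5 / L) + 2 / L + 3 / L := by ring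
  rw [e3, abs_le]
  constructor <;> linarith

theorem error_le {q V w : ℝ} (hq0 : 0 ≤ q) (hV0 : 0 ≤ V) (hw : 0 ≤ w) (hVW : V ≤ w + q) :
    2 * w * (5 * (V + 1)) + (2 + 3 * V) ^ 2 + V ≤ 60 * (1 + q) ^ 2 * (1 + w ^ 2) := by
  have h0 : (2 + 3 * V) ^ 2 ≤ (2 + 3 * (w + q)) ^ 2 :=
    pow_le_pow_left₀ (by linarith) (by linarith) 2
  have h3 : w * V ≤ w * (w + q) := mul_le_mul_of_nonneg_left hVW hw
  have h1 : 0 ≤ 1 + w ^ 2 - 2 * w := by nlinarith [sq_nonneg (w - 1)]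
  have h2 : 0 ≤ w ^ 2 * (q ^ 2 + q) := by positivity
  nlinarith [mul_nonneg hq0 h1, sq_nonneg w, mul_nonneg hq0 hw, sq_nonneg q]

/-- Second moment of `V` around the limit value `q` after one step. -/
theorem sum_sq_le {p q L Q : ℝ} {r N : ℕ} {c : ℕ → ℝ} (hp : 1 / 2 < p) (hp1 : p ≤ 1)
    (hq0 : 0 ≤ q) (hq : q * (2 * p - 1) = p ^ 2 / 2) (hL : 1 ≤ L) (hrN : r ≤ N)
    (hr1 : p * L ≤ r) (hr2 : r ≤ p * L + 1) (hrL : r ≤ L) (hc0 : ∀ k, 0 ≤ c k)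
    (hcL : ∀ k, c k ≤ L) (hcQ : ∑ k ∈ Finset.Icc 1 N, c k = Q) :
    ∑ k ∈ Finset.Icc 1 r, ((Q + (c k + k)) / (L + 1) ^ 2 - q) ^ 2 +
        ∑ k ∈ Finset.Ioc r N, ((Q + c k) / L ^ 2 - q) ^ 2 ≤
      N * (Q / L ^ 2 - q) ^ 2 - 2 * (2 * p - 1) * (Q / L ^ 2 - q) ^ 2 +
        60 * (1 + q) ^ 2 * (1 + (Q / L ^ 2 - q) ^ 2) / L := by
  have hL0 : 0 < L := by linarith
  obtain ⟨T, hT⟩ : ∃ T, T = ∑ k ∈ Finset.Icc 1 r, c k := ⟨_, rfl⟩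
  have hT0 : 0 ≤ T := hT ▸ Finset.sum_nonneg fun k _ => hc0 k
  have hTL : T ≤ L ^ 2 := by
    have : T ≤ r * L := by
      rw [hT]; refine (Finset.sum_le_card_nsmul _ _ L fun k _ => hcL k).trans ?_
      simp
    linarith [mul_le_mul_of_nonneg_right hrL hL0.le]
  have hT' : ∑ k ∈ Finset.Ioc r N, c k = Q - T := by
    rw [sum_Icc_split hrN] at hcQ; linarith
  have hQ : 0 ≤ Q := hcQ ▸ Finset.sum_nonneg fun k _ => hc0 k
  obtain ⟨V, hV⟩ : ∃ V, V = Q / L ^ 2 := ⟨_, rfl⟩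
  have hV0 : 0 ≤ V := by rw [hV]; positivity
  have hQV : Q = V * L ^ 2 := by rw [hV]; field_simp
  obtain ⟨W, hW⟩ : ∃ W, W = V - q := ⟨_, rfl⟩
  rw [← hV, ← hW]
  rw [hQV] at hT' ⊢
  have s1 := sum_sq_retained_le hL hrL hV0 hW hc0 hcL hT
  have s2 := sum_sq_rejected_le hL hrN hW hT0 hc0 hcL hT'
  have hε := abs_drift_add_le hp hp1 hq hL hr1 hr2 hrL hV0 hW hT0 hTL
  have h1 := mul_le_mul_of_nonneg_left hε (abs_nonneg W)
  rw [← abs_mul] at h1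
  have h2 := (le_abs_self _).trans h1
  have h3 := div_le_div_of_nonneg_right
    (error_le hq0 hV0 (abs_nonneg W) (by linarith [le_abs_self W])) hL0.le
  have e : (2 * |W| * (5 * (V + 1)) + (2 + 3 * V) ^ 2 + V) / L =
    2 * (|W| * (5 * (V + 1) / L)) + (2 + 3 * V) ^ 2 / L + V / L := by ring
  rw [sq_abs, e] at h3
  have e1 : (N : ℝ) * W ^ 2 = r * W ^ 2 + (N - r) * W ^ 2 := by ring
  have e2 := mul_add W ((T + r * (r + 1) / 2 - r * V * (2 * L + 1)) / (L + 1) ^ 2 +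
    (V * L ^ 2 - T) / L ^ 2) ((2 * p - 1) * W)
  have e3 := mul_add W ((T + r * (r + 1) / 2 - r * V * (2 * L + 1)) / (L + 1) ^ 2)
    ((V * L ^ 2 - T) / L ^ 2)
  linarith

/-- A weight comparable with `L⁻²` under which the rank sum has a uniformly negative drift. -/
noncomputable def weight (L : ℝ) : ℝ := if 2 ≤ L then ((L - 3 / 2) * (L - 1 / 2))⁻¹ else 0

theorem weight_nonneg (L : ℝ) : 0 ≤ weight L := by
  unfold weight
  split_ifs with h
  · exact inv_nonneg.2 (mul_nonneg (by linarith) (by linarith))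
  · exact le_rfl

/-- A negative drift requires `r` times the relative decrease of the weight to exceed `1`. For `L⁻²`
this quantity is `r(2L + 1) / (L + 1)²`, which is below `1` when `r = (L + 1) / 2`. The shifted
weight decreases by the factor `1 - 2 / (L + 1/2)`, which suffices for all `L ≥ 2`. -/
theorem sum_weight_le {p L Q : ℝ} {r N : ℕ} {c : ℕ → ℝ} (hp1 : p ≤ 1)
    (hL : 2 ≤ L) (hrN : r ≤ N) (hr1 : p * L ≤ r) (hr2 : L + 1 ≤ 2 * r) (hrL : r ≤ L)
    (hc0 : ∀ k, 0 ≤ c k) (hcQ : ∑ k ∈ Finset.Icc 1 N, c k = Q) :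
    ∑ k ∈ Finset.Icc 1 r, (Q + (c k + k)) * weight (L + 1) +
        ∑ k ∈ Finset.Ioc r N, (Q + c k) * weight L ≤
      N * (Q * weight L) + (4 - (2 * p - 1) / 3 * (Q * weight L)) := by
  obtain ⟨T, hT⟩ : ∃ T, T = ∑ k ∈ Finset.Icc 1 r, c k := ⟨_, rfl⟩
  have hT0 : 0 ≤ T := hT ▸ Finset.sum_nonneg fun k _ => hc0 k
  have hT' : ∑ k ∈ Finset.Ioc r N, c k = Q - T := by
    rw [sum_Icc_split hrN] at hcQ; linarith
  have hQ : 0 ≤ Q := hcQ ▸ Finset.sum_nonneg fun k _ => hc0 k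
  rw [← Finset.sum_mul, ← Finset.sum_mul, Finset.sum_add_distrib, Finset.sum_add_distrib,
    Finset.sum_add_distrib, ← hT, hT', sum_Icc_id]
  simp only [Finset.sum_const, Nat.card_Icc, Nat.card_Ioc, nsmul_eq_mul, Nat.add_sub_cancel]
  rw [Nat.cast_sub hrN]
  have hw0 := weight_nonneg L
  have hw : weight (L + 1) = weight L - weight L * (2 / (L + 1 / 2)) := by
    rw [weight, weight, if_pos hL, if_pos (by linarith)]
    obtain ⟨a, ha⟩ : ∃ a, a = L - 1 / 2 := ⟨_, rfl⟩
    have h1 : a - 1 ≠ 0 := by linarith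
    have h2 : a ≠ 0 := by linarith
    have h3 : a + 1 ≠ 0 := by linarith
    have h4 : L = a + 1 / 2 := by linarith
    have e1 : a + 1 / 2 + 1 - 3 / 2 = a := by ring
    have e2 : a + 1 / 2 + 1 - 1 / 2 = a + 1 := by ring
    have e3 : a + 1 / 2 - 3 / 2 = a - 1 := by ring
    have e4 : a + 1 / 2 - 1 / 2 = a := by ring
    have e5 : a + 1 / 2 + 1 / 2 = a + 1 := by ring
    rw [h4, e1, e2, e3, e4, e5]
    field_simp
    ring
  have hle : weight (L + 1) ≤ weight L := by
    rw [hw]; exact sub_le_self _ (mul_nonneg hw0 (by positivity))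
  have hdr : 1 + (2 * p - 1) / 3 ≤ r * (2 / (L + 1 / 2)) := by
    rw [← mul_div_assoc, le_div_iff₀ (by linarith)]
    -- The bound `r ≥ pL` serves when `(2p - 1)L ≥ 1`, and `r ≥ (L + 1) / 2` otherwise; the divisor
    -- `3` suits both cases.
    rcases le_total 1 ((2 * p - 1) * L) with h | h <;> nlinarith
  have h4 : r * (r + 1) / 2 * weight (L + 1) ≤ 4 := by
    rw [weight, if_pos (by linarith), ← div_eq_mul_inv,
      div_le_iff₀ (mul_pos (by linarith) (by linarith))]
    have : (0 : ℝ) ≤ r := Nat.cast_nonneg r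
    nlinarith
  have h5 := mul_le_mul_of_nonneg_left hdr (mul_nonneg hQ hw0)
  have h6 := mul_le_mul_of_nonneg_left hle hT0
  have h7 : (r * Q : ℝ) * weight (L + 1) =
      r * Q * weight L - Q * weight L * (r * (2 / (L + 1 / 2))) := by rw [hw]; ring
  nlinarith

/-! ### Drifts in terms of the relative ranks -/

theorem percentile_bounds {p : ℝ} (hp : 1 / 2 < p) (hp1 : p ≤ 1) {L : ℕ} (hL : 1 ≤ L) :
    p * L ≤ percentile p L ∧ (percentile p L : ℝ) ≤ p * L + 1 ∧ percentile p L ≤ L ∧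
      L + 1 ≤ 2 * percentile p L := by
  have hL' : (1 : ℝ) ≤ L := by exact_mod_cast hL
  rw [percentile, if_neg (by omega)]
  have h1 := Nat.le_ceil (p * L)
  refine ⟨h1, (Nat.ceil_lt_add_one (by positivity)).le, Nat.ceil_le.2 (by nlinarith), ?_⟩
  have : (L : ℝ) < 2 * (⌈p * L⌉₊ : ℕ) := by nlinarith
  have : L < 2 * ⌈p * L⌉₊ := by exact_mod_cast this
  omega

/-- The number of retained items, as a function of the relative ranks. -/
noncomputable def numOf (p : ℝ) (l : List ℕ) : ℝ := (retainedRanks (percentile p) l).card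

/-- The rank sum of the retained items, as a function of the relative ranks. -/
noncomputable def sumOf (p : ℝ) (l : List ℕ) : ℝ := (retainedRanks (percentile p) l).sum

theorem one_le_numOf (p : ℝ) {n : ℕ} (hn : 1 ≤ n) {l : List ℕ} (hl : l ∈ rankLists n) :
    1 ≤ numOf p l := by
  obtain ⟨n, rfl⟩ := Nat.exists_eq_add_of_le' hn
  exact Nat.one_le_cast.2 (card_retainedRanks_pos p hl)

theorem sumOf_nonneg (p : ℝ) (l : List ℕ) : 0 ≤ sumOf p l := Nat.cast_nonneg _

theorem numOf_le_cons (p : ℝ) (k : ℕ) (l : List ℕ) : numOf p l ≤ numOf p (k :: l) :=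
  Nat.cast_le.2 (card_le_card_cons _ k l)

/-- One step of the chain in purely real terms, for an arbitrary test function `G` of `L` and `Q`;
the drift inequalities are then applied to `1 / L`, `Q * weight L` and `(V - q)²`. -/
theorem sum_cons_eq {p : ℝ} (hp : 1 / 2 < p) (hp1 : p ≤ 1) {n : ℕ} (hn : 1 ≤ n) {l : List ℕ}
    (hl : l ∈ rankLists n) :
    ∃ (r : ℕ) (c : ℕ → ℝ), r ≤ n + 1 ∧ p * numOf p l ≤ r ∧ r ≤ p * numOf p l + 1 ∧
      r ≤ numOf p l ∧ numOf p l + 1 ≤ 2 * r ∧ (∀ k, 0 ≤ c k) ∧ (∀ k, c k ≤ numOf p l) ∧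
      ∑ k ∈ Finset.Icc 1 (n + 1), c k = sumOf p l ∧
      ∀ G : ℝ → ℝ → ℝ, ∑ k ∈ Finset.Icc 1 (n + 1), G (numOf p (k :: l)) (sumOf p (k :: l)) =
        ∑ k ∈ Finset.Icc 1 r, G (numOf p l + 1) (sumOf p l + (c k + k)) +
          ∑ k ∈ Finset.Ioc r (n + 1), G (numOf p l) (sumOf p l + c k) := by
  set M := retainedRanks (percentile p) l with hM
  have hpos : 1 ≤ M.card := Nat.one_le_cast.1 (one_le_numOf p hn hl)
  have hle : M.card ≤ n := card_retainedRanks_le _ hl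
  obtain ⟨h1, h2, h3, h4⟩ := percentile_bounds hp hp1 hpos
  refine ⟨percentile p M.card, fun k => (M.countP (k ≤ ·) : ℕ), by omega, h1, h2,
    Nat.cast_le.2 h3, by unfold numOf; exact_mod_cast h4, fun k => Nat.cast_nonneg _,
    fun k => Nat.cast_le.2 (Multiset.countP_le_card _ _), ?_, fun G => ?_⟩
  · rw [← Nat.cast_sum, sum_countP_le M fun j hj => (le_of_mem_retainedRanks _ hl j hj).trans
      (Nat.le_succ n)]
    rfl
  · have := sum_rankStep_eq (percentile p) (N := n + 1) M (by omega) fun a b => G a b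
    simp only [Nat.cast_add, Nat.cast_one] at this
    exact this

/-- The decrease is `r / (L (L + 1))`, with `r ≥ pL` and `L + 1 ≤ 2L`. -/
theorem sum_inv_numOf_le {p : ℝ} (hp : 1 / 2 < p) (hp1 : p ≤ 1) {n : ℕ} (hn : 1 ≤ n)
    {l : List ℕ} (hl : l ∈ rankLists n) :
    ∑ k ∈ Finset.Icc 1 (n + 1), (numOf p (k :: l))⁻¹ ≤
      (n + 1 : ℝ) * (numOf p l)⁻¹ - p / 2 * (numOf p l)⁻¹ := by
  obtain ⟨r, c, hrN, hr1, -, -, -, -, -, -, h⟩ := sum_cons_eq hp hp1 hn hl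
  have hL := one_le_numOf p hn hl
  have hL0 : 0 < numOf p l := by linarith
  have h' := h fun a _ => a⁻¹
  simp only [Finset.sum_const, Nat.card_Icc, Nat.card_Ioc, nsmul_eq_mul, Nat.add_sub_cancel]
    at h'
  rw [Nat.cast_sub hrN] at h'
  push_cast at h'
  rw [h']
  have h2 : p / 2 * (numOf p l)⁻¹ ≤ r * ((numOf p l)⁻¹ - (numOf p l + 1)⁻¹) := by
    have e : (numOf p l)⁻¹ - (numOf p l + 1)⁻¹ = (numOf p l * (numOf p l + 1))⁻¹ := by
      field_simp; ring
    rw [e, ← div_eq_mul_inv, ← div_eq_mul_inv, div_le_div_iff₀ hL0 (by positivity)]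
    have h3 : p / 2 * (numOf p l + 1) ≤ r := by nlinarith
    linarith [mul_le_mul_of_nonneg_right h3 hL0.le]
  linarith

theorem eq_one_or_two_le {p : ℝ} (hp0 : 0 < p) (hp1 : p ≤ 1) {n : ℕ} (hn : 1 ≤ n)
    {l : List ℕ} (hl : l ∈ rankLists n) : numOf p l = 1 ∧ sumOf p l = 1 ∨ 2 ≤ numOf p l := by
  have h1 : 1 ≤ (retainedRanks (percentile p) l).card :=
    Nat.one_le_cast.1 (one_le_numOf p hn hl)
  rcases h1.eq_or_lt with h | h
  · refine .inl ⟨Nat.cast_eq_one.2 h.symm, Nat.cast_eq_one.2 ?_⟩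
    exact sum_eq_one_of_card_eq_one hp0 hp1 hl h.symm
  · exact .inr (Nat.ofNat_le_cast.2 h)

theorem sum_weight_numOf_le {p : ℝ} (hp : 1 / 2 < p) (hp1 : p ≤ 1) {n : ℕ} (hn : 1 ≤ n)
    {l : List ℕ} (hl : l ∈ rankLists n) :
    ∑ k ∈ Finset.Icc 1 (n + 1), sumOf p (k :: l) * weight (numOf p (k :: l)) ≤
      (n + 1 : ℝ) * (sumOf p l * weight (numOf p l)) +
        (4 - (2 * p - 1) / 3 * (sumOf p l * weight (numOf p l))) := by
  obtain ⟨r, c, hrN, hr1, hr2, hrL, hr3, hc0, hcL, hcQ, h⟩ := sum_cons_eq hp hp1 hn hl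
  rw [h fun a b => b * weight a]
  rcases eq_one_or_two_le (by linarith) hp1 hn hl with ⟨hL, hQ⟩ | hL
  · rw [hL] at hr3 hrL hcL
    have hr : r = 1 := by
      have : r ≤ 1 := by exact_mod_cast hrL
      have : (2 : ℝ) ≤ 2 * r := by linarith
      have : 2 ≤ 2 * r := by exact_mod_cast this
      omega
    have hw : weight 1 = 0 := if_neg (by norm_num)
    -- From `L = Q = 1`, acceptance leads to a rank sum at most `3` with weight `4 / 3`; this is the
    -- source of the constant `4`.
    have hw2 : weight (1 + 1) = 4 / 3 := by rw [weight, if_pos (by norm_num)]; norm_num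
    rw [hL, hQ, hr, hw, hw2]
    simp only [mul_zero, Finset.sum_const_zero, Finset.Icc_self, Finset.sum_singleton]
    have := hcL 1
    push_cast
    linarith
  · have := sum_weight_le hp1 hL hrN hr1 hr3 hrL hc0 hcQ
    push_cast at this
    exact this

theorem div_sq_le_weight {p : ℝ} (hp : 1 / 2 < p) (hp1 : p ≤ 1) {n : ℕ} (hn : 1 ≤ n)
    {l : List ℕ} (hl : l ∈ rankLists n) :
    sumOf p l / numOf p l ^ 2 ≤ 1 + sumOf p l * weight (numOf p l) := by
  rcases eq_one_or_two_le (by linarith) hp1 hn hl with ⟨hL, hQ⟩ | hL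
  · rw [hL, hQ, weight, if_neg (by norm_num)]
    norm_num
  · rw [weight, if_pos hL, div_eq_mul_inv]
    have : (numOf p l ^ 2)⁻¹ ≤ ((numOf p l - 3 / 2) * (numOf p l - 1 / 2))⁻¹ :=
      inv_anti₀ (mul_pos (by linarith) (by linarith)) (by nlinarith)
    linarith [mul_le_mul_of_nonneg_left this (sumOf_nonneg p l)]

/-- The quadratic deviation of `V` from `q`, with a correction making it a supermartingale. -/
noncomputable def potential (p q D : ℝ) (l : List ℕ) : ℝ :=
  (sumOf p l / numOf p l ^ 2 - q) ^ 2 + D * (numOf p l)⁻¹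

theorem sum_potential_le {p q : ℝ} (hp : 1 / 2 < p) (hp1 : p ≤ 1) (hq0 : 0 ≤ q)
    (hq : q * (2 * p - 1) = p ^ 2 / 2) :
    ∃ K D η : ℝ, 0 < K ∧ 0 < D ∧ 0 < η ∧ ∀ n : ℕ, 1 ≤ n → ∀ l ∈ rankLists n,
      K ≤ numOf p l → ∑ k ∈ Finset.Icc 1 (n + 1), potential p q D (k :: l) ≤
        (n + 1 : ℝ) * potential p q D l - η * potential p q D l := by
  obtain ⟨C, hC⟩ : ∃ C, C = 60 * (1 + q) ^ 2 := ⟨_, rfl⟩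
  have hC0 : 0 < C := by rw [hC]; positivity
  have hp0 : 0 < p := by linarith
  have hd : 0 < 2 * p - 1 := by linarith
  -- `K` makes the error `C (V - q)² / L` at most half of the quadratic drift. `D` gives a drift
  -- `-2C / L`: one half cancels the error `C / L`, the other pays for `η * D / L`, as `η ≤ p / 4`.
  refine ⟨C / (2 * p - 1), 4 * C / p, min (2 * p - 1) (p / 4), by positivity, by positivity,
    by positivity, fun n hn l hl hK => ?_⟩
  have hL := one_le_numOf p hn hl
  have hL0 : 0 < numOf p l := by linarith
  have hinv := sum_inv_numOf_le hp hp1 hn hl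
  obtain ⟨r, c, hrN, hr1, hr2, hrL, hr3, hc0, hcL, hcQ, h⟩ := sum_cons_eq hp hp1 hn hl
  have hsq := sum_sq_le hp hp1 hq0 hq hL hrN hr1 hr2 hrL hc0 hcL hcQ
  rw [← h fun a b => (b / a ^ 2 - q) ^ 2] at hsq
  unfold potential
  rw [Finset.sum_add_distrib, ← Finset.mul_sum]
  obtain ⟨W, hW⟩ : ∃ W, W = (sumOf p l / numOf p l ^ 2 - q) ^ 2 := ⟨_, rfl⟩
  have hW0 : 0 ≤ W := hW ▸ sq_nonneg _
  rw [← hW, ← hC] at hsq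
  rw [← hW]
  push_cast at hsq
  have hDinv := mul_le_mul_of_nonneg_left hinv (by positivity : 0 ≤ 4 * C / p)
  have e1 : 4 * C / p * ((n + 1 : ℝ) * (numOf p l)⁻¹ - p / 2 * (numOf p l)⁻¹) =
      (n + 1 : ℝ) * (4 * C / p * (numOf p l)⁻¹) - 2 * C * (numOf p l)⁻¹ := by
    field_simp; ring
  rw [e1] at hDinv
  have h1 : C * (numOf p l)⁻¹ ≤ 2 * p - 1 := by
    rw [← div_eq_mul_inv, div_le_iff₀ hL0]
    rw [div_le_iff₀ hd] at hK
    linarith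
  have h2 := mul_le_mul_of_nonneg_right h1 hW0
  have h3 : C * (1 + W) / numOf p l = C * (numOf p l)⁻¹ + C * (numOf p l)⁻¹ * W := by ring
  rw [h3] at hsq
  have h4 : min (2 * p - 1) (p / 4) * W ≤ (2 * p - 1) * W :=
    mul_le_mul_of_nonneg_right (min_le_left _ _) hW0
  have h5 : min (2 * p - 1) (p / 4) * (4 * C / p * (numOf p l)⁻¹) ≤
      p / 4 * (4 * C / p * (numOf p l)⁻¹) :=
    mul_le_mul_of_nonneg_right (min_le_right _ _) (by positivity)
  have h6 : p / 4 * (4 * C / p * (numOf p l)⁻¹) = C * (numOf p l)⁻¹ := by field_simp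
  rw [h6] at h5
  linarith

/-! ### Contracting sequences -/

/-- Since `1 - x ≤ exp (-x)`, the product of the factors is at most the exponential of minus `η`
times a harmonic sum. -/
theorem tendsto_zero_of_contraction {b : ℕ → ℝ} {η : ℝ} (hη : 0 < η) (hb : ∀ n, 0 ≤ b n)
    {N : ℕ} (h : ∀ n ≥ N, b (n + 1) ≤ (1 - η / (n + 1)) * b n) : Tendsto b atTop (𝓝 0) := by
  set H : ℕ → ℝ := fun n => ∑ i ∈ Finset.range n, (1 / ((i : ℝ) + 1)) with hH
  have hHt : Tendsto H atTop atTop := Real.tendsto_sum_range_one_div_nat_succ_atTop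
  have hbound : ∀ n ≥ N, b n ≤ b N * Real.exp (η * H N) * Real.exp (-(η * H n)) := by
    intro n hn
    induction n, hn using Nat.le_induction with
    | base => rw [mul_assoc, ← Real.exp_add]; simp
    | succ n hn ih =>
      have h1 : 1 - η / (n + 1) ≤ Real.exp (-(η / (n + 1))) := by
        linarith [Real.add_one_le_exp (-(η / ((n : ℝ) + 1)))]
      have h2 : H (n + 1) = H n + 1 / ((n : ℝ) + 1) := Finset.sum_range_succ _ _
      have h3 : Real.exp (-(η * H (n + 1))) =
          Real.exp (-(η / (n + 1))) * Real.exp (-(η * H n)) := by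
        rw [← Real.exp_add, h2]; congr 1; ring
      calc b (n + 1) ≤ (1 - η / (n + 1)) * b n := h n hn
        _ ≤ Real.exp (-(η / (n + 1))) * b n := mul_le_mul_of_nonneg_right h1 (hb n)
        _ ≤ Real.exp (-(η / (n + 1))) * (b N * Real.exp (η * H N) * Real.exp (-(η * H n))) :=
          mul_le_mul_of_nonneg_left ih (Real.exp_pos _).le
        _ = _ := by rw [h3]; ring
  have hlim : Tendsto (fun n => b N * Real.exp (η * H N) * Real.exp (-(η * H n))) atTop
      (𝓝 0) := by
    have := (Real.tendsto_exp_neg_atTop_nhds_zero.comp (hHt.const_mul_atTop hη)).const_mul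
      (b N * Real.exp (η * H N))
    simpa using this
  exact squeeze_zero' (Eventually.of_forall hb)
    (eventually_atTop.2 ⟨N, hbound⟩) hlim

/-- The excess over the equilibrium `a / η` contracts; `η ≤ 1` keeps the factor nonnegative, so the
positive part may be taken. -/
theorem eventually_le_of_contraction {b : ℕ → ℝ} {η a : ℝ} (hη : 0 < η) (hη1 : η ≤ 1)
    {N : ℕ} (h : ∀ n ≥ N, b (n + 1) ≤ b n + (a - η * b n) / (n + 1)) {ε : ℝ} (hε : 0 < ε) :
    ∀ᶠ n in atTop, b n ≤ a / η + ε := by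
  have ht : Tendsto (fun n => max (b n - a / η) 0) atTop (𝓝 0) := by
    refine tendsto_zero_of_contraction hη (fun n => le_max_right _ _) (N := N) fun n hn => ?_
    have hn0 : (0 : ℝ) < n + 1 := by positivity
    have h1 : 0 ≤ 1 - η / (n + 1) := by
      rw [sub_nonneg, div_le_one hn0]
      linarith [(Nat.cast_nonneg n : (0 : ℝ) ≤ n)]
    refine max_le ?_ (mul_nonneg h1 (le_max_right _ _))
    refine le_trans ?_ (mul_le_mul_of_nonneg_left (le_max_left _ _) h1)
    have e : (1 - η / (n + 1)) * (b n - a / η) = b n + (a - η * b n) / (n + 1) - a / η := by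
      field_simp; ring
    rw [e]
    linarith [h n hn]
  filter_upwards [ht.eventually (gt_mem_nhds hε)] with n hn
  linarith [le_max_left (b n - a / η) 0]

/-! ### Almost sure convergence and convergence of means -/

section Convergence

variable {Ω : Type*} [MeasurableSpace Ω] {μ : Measure Ω} [IsProbabilityMeasure μ]
  {X : ℕ → Ω → ℝ}

theorem tendsto_integral_inv_numOf (hX : ∀ i, Measurable (X i))
    (hord : OrderingsEquallyLikely μ X) {p : ℝ} (hp : 1 / 2 < p) (hp1 : p ≤ 1) :
    Tendsto (fun n => ∫ ω, (numOf p (relRanks (fun j => X j ω) n))⁻¹ ∂μ) atTop (𝓝 0) := by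
  refine tendsto_zero_of_contraction (η := p / 2) (by linarith)
    (fun n => integral_nonneg fun ω => inv_nonneg.2 (Nat.cast_nonneg _)) (N := 1)
    fun n hn => ?_
  have h := setIntegral_succ_le hX hord (n := n) (f := fun l => (numOf p l)⁻¹)
    (g := fun l => (1 - p / 2 / (n + 1)) * (numOf p l)⁻¹) (P := fun _ => True)
    (fun l hl _ => by
      refine (sum_inv_numOf_le hp hp1 hn hl).trans (le_of_eq ?_)
      field_simp) (s := Set.univ) MeasurableSet.univ fun _ _ => trivial
  rwa [setIntegral_univ, setIntegral_univ, integral_const_mul] at h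

/-- The event that at least `K` items are retained among the first `N`. -/
def retainedAtLeast (X : ℕ → Ω → ℝ) (p K : ℝ) (N : ℕ) : Set Ω :=
  {ω | K ≤ numOf p (relRanks (fun j => X j ω) N)}

theorem measurableSet_retainedAtLeast (hX : ∀ i, Measurable (X i)) (p K : ℝ) {N n : ℕ}
    (h : N ≤ n) : MeasurableSet[rankFiltration hX n] (retainedAtLeast X p K N) :=
  (rankFiltration hX).mono h _ ⟨{l | K ≤ numOf p l}, trivial, rfl⟩

theorem numOf_relRanks_mono (p : ℝ) (x : ℕ → ℝ) : Monotone fun n => numOf p (relRanks x n) :=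
  monotone_nat_of_le_succ fun _ => numOf_le_cons p _ _

/-- Markov's inequality for `1 / L_N`. -/
theorem tendsto_measure_compl_retainedAtLeast (hX : ∀ i, Measurable (X i))
    (hord : OrderingsEquallyLikely μ X) {p : ℝ} (hp : 1 / 2 < p) (hp1 : p ≤ 1) {K : ℝ}
    (hK : 0 < K) :
    Tendsto (fun N => μ.real (retainedAtLeast X p K N)ᶜ) atTop (𝓝 0) := by
  have h := (tendsto_integral_inv_numOf hX hord hp hp1).const_mul K
  rw [mul_zero] at h
  refine squeeze_zero' (Eventually.of_forall fun _ => measureReal_nonneg) ?_ h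
  -- At `N = 0` nothing is retained and the inverse takes the default value `0`, so the inclusion
  -- below needs `N ≥ 1`.
  filter_upwards [eventually_ge_atTop 1] with N hN
  have hm := mul_meas_ge_le_integral_of_nonneg (μ := μ)
    (ae_of_all _ fun ω => inv_nonneg.2 (Nat.cast_nonneg _))
    (integrable_comp_relRanks hX N fun l => (numOf p l)⁻¹) K⁻¹
  have hsub : (retainedAtLeast X p K N)ᶜ ⊆
      {ω | K⁻¹ ≤ (numOf p (relRanks (fun j => X j ω) N))⁻¹} := by
    intro ω hω
    have h1 := one_le_numOf p hN (relRanks_mem_rankLists (fun j => X j ω) N)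
    have h2 : numOf p (relRanks (fun j => X j ω) N) < K := not_le.1 hω
    exact inv_anti₀ (by linarith) h2.le
  calc μ.real (retainedAtLeast X p K N)ᶜ
      ≤ μ.real {ω | K⁻¹ ≤ (numOf p (relRanks (fun j => X j ω) N))⁻¹} := measureReal_mono hsub
    _ = K * (K⁻¹ * μ.real {ω | K⁻¹ ≤ (numOf p (relRanks (fun j => X j ω) N))⁻¹}) := by
        field_simp
    _ ≤ _ := mul_le_mul_of_nonneg_left hm hK.le

/-- The almost sure limit of a process that decreases in conditional mean and tends to zero in
mean, on an event `A` known at time `N`. -/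
theorem ae_tendsto_zero_of_drift (hX : ∀ i, Measurable (X i)) {f : List ℕ → ℝ}
    (hf : ∀ l, 0 ≤ f l) {A : Set Ω} {N : ℕ} (hA : MeasurableSet[rankFiltration hX N] A)
    (hdrift : ∀ n ≥ N, ∀ s : Set Ω, s ⊆ A → MeasurableSet[rankFiltration hX n] s →
      ∫ ω in s, f (relRanks (fun j => X j ω) (n + 1)) ∂μ ≤
        ∫ ω in s, f (relRanks (fun j => X j ω) n) ∂μ)
    (hlim : Tendsto (fun n => ∫ ω in A, f (relRanks (fun j => X j ω) n) ∂μ) atTop (𝓝 0)) :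
    ∀ᵐ ω ∂μ, ω ∈ A → Tendsto (fun n => f (relRanks (fun j => X j ω) n)) atTop (𝓝 0) := by
  have hA' : MeasurableSet A := (rankFiltration hX).le N A hA
  -- Time is shifted by `N`, so that `A` is known from the start and the restricted process is
  -- adapted.
  let 𝒢 : Filtration ℕ ‹MeasurableSpace Ω› :=
    ⟨fun n => rankFiltration hX (n + N), fun a b h => (rankFiltration hX).mono (by omega),
      fun n => (rankFiltration hX).le _⟩
  let Z : ℕ → Ω → ℝ := fun n => A.indicator fun ω => f (relRanks (fun j => X j ω) (n + N))
  have hZ0 : ∀ n ω, 0 ≤ Z n ω := fun n ω => Set.indicator_nonneg (fun _ _ => hf _) _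
  have hZint : ∀ n, Integrable (Z n) μ := fun n =>
    (integrable_comp_relRanks hX (n + N) f).indicator hA'
  have hZadp : ∀ n, StronglyMeasurable[𝒢 n] (Z n) := fun n =>
    ((measurable_rankFiltration hX f).indicator
      ((rankFiltration hX).mono (Nat.le_add_left N n) A hA)).stronglyMeasurable
  have hZA : ∀ n, ∫ ω, Z n ω ∂μ = ∫ ω in A, f (relRanks (fun j => X j ω) (n + N)) ∂μ :=
    fun n => integral_indicator hA'
  have hsub : Submartingale (fun n ω => -Z n ω) 𝒢 μ := by
    refine submartingale_of_setIntegral_le_succ (fun n => (hZadp n).neg)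
      (fun n => (hZint n).neg) fun n s hs => ?_
    rw [integral_neg, integral_neg, neg_le_neg_iff, setIntegral_indicator hA',
      setIntegral_indicator hA']
    have := hdrift (n + N) (by omega) (s ∩ A) Set.inter_subset_right
      (hs.inter ((rankFiltration hX).mono (Nat.le_add_left N n) A hA))
    rwa [Nat.add_right_comm] at this
  have hnorm : ∀ n, eLpNorm (Z n) 1 μ = ENNReal.ofReal (∫ ω, Z n ω ∂μ) := by
    intro n
    rw [eLpNorm_one_eq_lintegral_enorm, ← ofReal_integral_norm_eq_lintegral_enorm (hZint n)]
    congr 1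
    exact integral_congr_ae (ae_of_all _ fun ω => Real.norm_of_nonneg (hZ0 n ω))
  have hanti : Antitone fun n => ∫ ω, Z n ω ∂μ := by
    refine antitone_nat_of_succ_le fun n => ?_
    rw [hZA, hZA]
    have := hdrift (n + N) (by omega) A subset_rfl
      ((rankFiltration hX).mono (Nat.le_add_left N n) A hA)
    rwa [Nat.add_right_comm] at this
  have hconv := hsub.exists_ae_tendsto_of_bdd (R := (∫ ω, Z 0 ω ∂μ).toNNReal) fun n => by
    have : eLpNorm (fun ω => -Z n ω) 1 μ = eLpNorm (Z n) 1 μ := eLpNorm_neg (Z n) 1 μ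
    rw [this, hnorm]
    exact ENNReal.ofReal_le_ofReal (hanti (Nat.zero_le n))
  have hL1 : Tendsto (fun n => eLpNorm (Z n - 0) 1 μ) atTop (𝓝 0) := by
    simp only [sub_zero, hnorm, hZA]
    have := ENNReal.tendsto_ofReal (hlim.comp (tendsto_add_atTop_nat N))
    simpa using this
  -- Martingale convergence gives some limit; convergence in mean gives the limit `0` along a
  -- subsequence, which identifies it.
  obtain ⟨ns, hns, hsubseq⟩ := (tendstoInMeasure_of_tendsto_eLpNorm one_ne_zero
    (fun n => (hZint n).aestronglyMeasurable) aestronglyMeasurable_zero hL1).exists_seq_tendsto_ae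
  filter_upwards [hconv, hsubseq] with ω ⟨c, hc⟩ h0 hω
  have hc' : c = 0 := by
    have h1 := hc.comp hns.tendsto_atTop
    have h2 := h0.neg
    simpa using tendsto_nhds_unique h1 h2
  have h3 : Tendsto (fun n => Z n ω) atTop (𝓝 0) := by simpa [hc'] using hc.neg
  rw [← tendsto_add_atTop_iff_nat N]
  refine h3.congr fun n => ?_
  exact Set.indicator_of_mem hω _

theorem potential_nonneg {p q D : ℝ} (hD : 0 ≤ D) (l : List ℕ) : 0 ≤ potential p q D l :=
  add_nonneg (sq_nonneg _) (mul_nonneg hD (inv_nonneg.2 (Nat.cast_nonneg _)))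

theorem setIntegral_potential_le (hX : ∀ i, Measurable (X i))
    (hord : OrderingsEquallyLikely μ X) {p q K D η : ℝ}
    (hpot : ∀ n : ℕ, 1 ≤ n → ∀ l ∈ rankLists n, K ≤ numOf p l →
      ∑ k ∈ Finset.Icc 1 (n + 1), potential p q D (k :: l) ≤
        (n + 1 : ℝ) * potential p q D l - η * potential p q D l)
    {N n : ℕ} (hN : 1 ≤ N) (hn : N ≤ n) {s : Set Ω} (hs : MeasurableSet[rankFiltration hX n] s)
    (hsA : s ⊆ retainedAtLeast X p K N) :
    ∫ ω in s, potential p q D (relRanks (fun j => X j ω) (n + 1)) ∂μ ≤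
      (1 - η / (n + 1)) * ∫ ω in s, potential p q D (relRanks (fun j => X j ω) n) ∂μ := by
  rw [← integral_const_mul]
  refine setIntegral_succ_le hX hord (f := potential p q D)
    (g := fun l => (1 - η / (n + 1)) * potential p q D l) (P := fun l => K ≤ numOf p l)
    (fun l hl hP => (hpot n (hN.trans hn) l hl hP).trans (le_of_eq ?_)) hs fun ω hω =>
      le_trans (hsA hω) (numOf_relRanks_mono p _ hn)
  field_simp

theorem ae_tendsto_of_potential (hX : ∀ i, Measurable (X i))
    (hord : OrderingsEquallyLikely μ X) {p q K D η : ℝ} (hp : 1 / 2 < p) (hp1 : p ≤ 1)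
    (hK : 0 < K) (hD : 0 < D) (hη : 0 < η)
    (hpot : ∀ n : ℕ, 1 ≤ n → ∀ l ∈ rankLists n, K ≤ numOf p l →
      ∑ k ∈ Finset.Icc 1 (n + 1), potential p q D (k :: l) ≤
        (n + 1 : ℝ) * potential p q D l - η * potential p q D l)
    (hlim : ∀ N ≥ 1, Tendsto (fun n => ∫ ω in retainedAtLeast X p K N,
      potential p q D (relRanks (fun j => X j ω) n) ∂μ) atTop (𝓝 0)) :
    ∀ᵐ ω ∂μ, Tendsto (fun n => sumOf p (relRanks (fun j => X j ω) n) /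
      numOf p (relRanks (fun j => X j ω) n) ^ 2) atTop (𝓝 q) := by
  have hpot0 := potential_nonneg (p := p) (q := q) hD.le
  have hex : ∀ᵐ ω ∂μ, ∃ N, 1 ≤ N ∧ ω ∈ retainedAtLeast X p K N := by
    rw [ae_iff, ← measureReal_eq_zero_iff]
    refine le_antisymm (ge_of_tendsto
      (tendsto_measure_compl_retainedAtLeast hX hord hp hp1 hK) ?_) measureReal_nonneg
    filter_upwards [eventually_ge_atTop 1] with N hN
    exact measureReal_mono fun ω hω hmem => hω ⟨N, hN, hmem⟩
  have hae : ∀ᵐ ω ∂μ, ∀ N, 1 ≤ N → ω ∈ retainedAtLeast X p K N →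
      Tendsto (fun n => potential p q D (relRanks (fun j => X j ω) n)) atTop (𝓝 0) := by
    refine ae_all_iff.2 fun N => ?_
    by_cases hN : 1 ≤ N
    · have := ae_tendsto_zero_of_drift hX hpot0
        (measurableSet_retainedAtLeast hX p K le_rfl) (fun n hn s hsA hs => ?_) (hlim N hN)
      · filter_upwards [this] with ω h _ using h
      · refine (setIntegral_potential_le hX hord hpot hN hn hs hsA).trans ?_
        refine mul_le_of_le_one_left (integral_nonneg fun ω => hpot0 _) ?_
        have : 0 ≤ η / ((n : ℝ) + 1) := by positivity
        linarith
    · exact ae_of_all _ fun ω h => absurd h hN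
  filter_upwards [hex, hae] with ω ⟨N, hN, hω⟩ h
  have h0 := h N hN hω
  have hsq : Tendsto (fun n => (sumOf p (relRanks (fun j => X j ω) n) /
      numOf p (relRanks (fun j => X j ω) n) ^ 2 - q) ^ 2) atTop (𝓝 0) :=
    squeeze_zero (fun _ => sq_nonneg _) (fun n => le_add_of_nonneg_right
      (mul_nonneg hD.le (inv_nonneg.2 (Nat.cast_nonneg _)))) h0
  have habs := hsq.sqrt
  simp only [Real.sqrt_sq_eq_abs, Real.sqrt_zero] at habs
  exact tendsto_sub_nhds_zero_iff.1 (tendsto_zero_iff_abs_tendsto_zero _ |>.2 habs)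

theorem setIntegral_weight_le (hX : ∀ i, Measurable (X i))
    (hord : OrderingsEquallyLikely μ X) {p : ℝ} (hp : 1 / 2 < p) (hp1 : p ≤ 1) {n : ℕ}
    (hn : 1 ≤ n) {s : Set Ω} (hs : MeasurableSet[rankFiltration hX n] s) :
    ∫ ω in s, sumOf p (relRanks (fun j => X j ω) (n + 1)) *
        weight (numOf p (relRanks (fun j => X j ω) (n + 1))) ∂μ ≤
      ∫ ω in s, sumOf p (relRanks (fun j => X j ω) n) *
        weight (numOf p (relRanks (fun j => X j ω) n)) ∂μ +
      (4 * μ.real s - (2 * p - 1) / 3 * ∫ ω in s, sumOf p (relRanks (fun j => X j ω) n) *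
        weight (numOf p (relRanks (fun j => X j ω) n)) ∂μ) / (n + 1) := by
  have h := setIntegral_succ_le hX hord (f := fun l => sumOf p l * weight (numOf p l))
    (g := fun l => sumOf p l * weight (numOf p l) +
      (4 - (2 * p - 1) / 3 * (sumOf p l * weight (numOf p l))) / (n + 1)) (P := fun _ => True)
    (fun l hl _ => (sum_weight_numOf_le hp hp1 hn hl).trans (le_of_eq (by field_simp)))
    hs fun _ _ => trivial
  have hint : IntegrableOn (fun ω => sumOf p (relRanks (fun j => X j ω) n) *
      weight (numOf p (relRanks (fun j => X j ω) n))) s μ :=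
    (integrable_comp_relRanks hX n fun l => sumOf p l * weight (numOf p l)).integrableOn
  refine h.trans (le_of_eq ?_)
  have hint' : IntegrableOn (fun ω => (4 - (2 * p - 1) / 3 *
      (sumOf p (relRanks (fun j => X j ω) n) * weight (numOf p (relRanks (fun j => X j ω) n)))) /
        ((n : ℝ) + 1)) s μ :=
    (integrable_comp_relRanks hX n fun l =>
      (4 - (2 * p - 1) / 3 * (sumOf p l * weight (numOf p l))) / ((n : ℝ) + 1)).integrableOn
  rw [integral_add hint hint', integral_div, integral_sub (integrable_const _) (hint.const_mul _), integral_const_mul,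
    setIntegral_const, smul_eq_mul, mul_comm (μ.real s)]

/-- On the event `A`, `|V - q|` is at most `ε` plus the potential over `ε`. On its complement, the
mean of `Q * weight L` is eventually at most `4 P(Aᶜ) / δ + ε`, and `N` is chosen to make `P(Aᶜ)`
small. -/
theorem tendsto_integral_of_potential (hX : ∀ i, Measurable (X i))
    (hord : OrderingsEquallyLikely μ X) {p q K D : ℝ} (hp : 1 / 2 < p) (hp1 : p ≤ 1)
    (hq0 : 0 ≤ q) (hK : 0 < K) (hD : 0 < D)
    (hlim : ∀ N ≥ 1, Tendsto (fun n => ∫ ω in retainedAtLeast X p K N,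
      potential p q D (relRanks (fun j => X j ω) n) ∂μ) atTop (𝓝 0)) :
    Tendsto (fun n => ∫ ω, sumOf p (relRanks (fun j => X j ω) n) /
      numOf p (relRanks (fun j => X j ω) n) ^ 2 ∂μ) atTop (𝓝 q) := by
  rw [Metric.tendsto_nhds]
  intro ε' hε'
  obtain ⟨ε, hε, hεε⟩ : ∃ ε > 0, 5 * ε = ε' := ⟨ε' / 5, by positivity, by ring⟩
  obtain ⟨δ, hδ⟩ : ∃ δ, δ = (2 * p - 1) / 3 := ⟨_, rfl⟩
  have hδ0 : 0 < δ := by rw [hδ]; linarith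
  have hsmall := ((tendsto_measure_compl_retainedAtLeast hX hord hp hp1 hK).const_mul
    (1 + q + 4 / δ)).eventually (gt_mem_nhds (by rwa [mul_zero] : (1 + q + 4 / δ) * 0 < ε))
  obtain ⟨N, hNP, hN⟩ := (hsmall.and (eventually_ge_atTop 1)).exists
  set A := retainedAtLeast X p K N with hA
  have hAm : ∀ n ≥ N, MeasurableSet[rankFiltration hX n] A := fun n hn =>
    measurableSet_retainedAtLeast hX p K hn
  have hAm' : MeasurableSet A := (rankFiltration hX).le N _ (hAm N le_rfl)
  have hF := eventually_le_of_contraction (η := δ) (a := 4 * μ.real Aᶜ)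
    (b := fun n => ∫ ω in Aᶜ, sumOf p (relRanks (fun j => X j ω) n) *
        weight (numOf p (relRanks (fun j => X j ω) n)) ∂μ) hδ0 (by rw [hδ]; linarith) (N := N)
    (fun n hn => by
      rw [hδ]; exact setIntegral_weight_le hX hord hp hp1 (hN.trans hn) (hAm n hn).compl) hε
  have hy := (hlim N hN).eventually (gt_mem_nhds (pow_pos hε 2))
  filter_upwards [hF, hy, eventually_ge_atTop 1] with n hFn hyn hn
  have hintV := integrable_comp_relRanks (μ := μ) hX n fun l => sumOf p l / numOf p l ^ 2
  have hintY := integrable_comp_relRanks (μ := μ) hX n fun l => potential p q D l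
  have hintF := integrable_comp_relRanks (μ := μ) hX n fun l => sumOf p l * weight (numOf p l)
  have hintW := integrable_comp_relRanks (μ := μ) hX n fun l => |sumOf p l / numOf p l ^ 2 - q|
  have e1 : ∫ ω, sumOf p (relRanks (fun j => X j ω) n) /
      numOf p (relRanks (fun j => X j ω) n) ^ 2 ∂μ - q =
      ∫ ω, (sumOf p (relRanks (fun j => X j ω) n) /
      numOf p (relRanks (fun j => X j ω) n) ^ 2 - q) ∂μ := by
    rw [integral_sub hintV (integrable_const q)]; simp
  rw [Real.dist_eq, e1]
  refine (abs_integral_le_integral_abs).trans_lt ?_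
  rw [← integral_add_compl hAm' hintW]
  have b1 : ∫ ω in A, |sumOf p (relRanks (fun j => X j ω) n) /
      numOf p (relRanks (fun j => X j ω) n) ^ 2 - q| ∂μ ≤ ε + ε := by
    calc _ ≤ ∫ ω in A, (ε + potential p q D (relRanks (fun j => X j ω) n) / ε) ∂μ := by
          refine integral_mono hintW.integrableOn
            ((integrable_const _).add (hintY.integrableOn.div_const _)) fun ω => ?_
          simp only [potential]
          obtain ⟨w, hw⟩ : ∃ w, w = |sumOf p (relRanks (fun j => X j ω) n) /
            numOf p (relRanks (fun j => X j ω) n) ^ 2 - q| := ⟨_, rfl⟩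
          have h0 : 0 ≤ D * (numOf p (relRanks (fun j => X j ω) n))⁻¹ :=
            mul_nonneg hD.le (inv_nonneg.2 (Nat.cast_nonneg _))
          -- This is `w ≤ ε + w² / ε`, which trades the first moment for the second.
          rw [← sq_abs (_ - q), ← hw, ← sub_le_iff_le_add', le_div_iff₀ hε]
          nlinarith [sq_nonneg (w - ε), sq_nonneg w]
      _ = μ.real A * ε + (∫ ω in A, potential p q D (relRanks (fun j => X j ω) n) ∂μ) / ε := by
          rw [integral_add (integrable_const _) (hintY.integrableOn.div_const _), integral_div,
            setIntegral_const, smul_eq_mul]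
      _ ≤ ε + ε := by
          refine add_le_add (mul_le_of_le_one_left hε.le measureReal_le_one) ?_
          rw [div_le_iff₀ hε, ← sq]
          exact hyn.le
  have b2 : ∫ ω in Aᶜ, |sumOf p (relRanks (fun j => X j ω) n) /
      numOf p (relRanks (fun j => X j ω) n) ^ 2 - q| ∂μ ≤
      μ.real Aᶜ * (1 + q) + (4 * μ.real Aᶜ / δ + ε) := by
    calc _ ≤ ∫ ω in Aᶜ, ((1 + q) + sumOf p (relRanks (fun j => X j ω) n) *
            weight (numOf p (relRanks (fun j => X j ω) n))) ∂μ := by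
          refine integral_mono hintW.integrableOn
            ((integrable_const _).add hintF.integrableOn) fun ω => ?_
          have h1 := div_sq_le_weight hp hp1 hn (relRanks_mem_rankLists (fun j => X j ω) n)
          have h2 : 0 ≤ sumOf p (relRanks (fun j => X j ω) n) /
            numOf p (relRanks (fun j => X j ω) n) ^ 2 :=
            div_nonneg (sumOf_nonneg p _) (sq_nonneg _)
          exact abs_le.2 ⟨by linarith, by linarith⟩
      _ = μ.real Aᶜ * (1 + q) + ∫ ω in Aᶜ, sumOf p (relRanks (fun j => X j ω) n) *
            weight (numOf p (relRanks (fun j => X j ω) n)) ∂μ := by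
          rw [integral_add (integrable_const _) hintF.integrableOn, setIntegral_const,
            smul_eq_mul]
      _ ≤ _ := by linarith
  have e2 : μ.real Aᶜ * (1 + q) + (4 * μ.real Aᶜ / δ + ε) =
      (1 + q + 4 / δ) * μ.real Aᶜ + ε := by ring
  have b12 := add_le_add b1 b2
  rw [e2] at b12
  refine lt_of_le_of_lt b12 ?_
  linarith

end Convergence

end RankSelection

theorem theorem5p3 {Ω : Type*} [MeasurableSpace Ω] (μ : Measure Ω) [IsProbabilityMeasure μ]
    (X : ℕ → Ω → ℝ) (hX : ∀ i, Measurable (X i))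
    (hord : RankSelection.OrderingsEquallyLikely μ X)
    (p : ℝ) (hp : 1 / 2 < p) (hp1 : p ≤ 1) :
    (∀ (n : ℕ) (ω : Ω),
      RankSelection.normalizedRankSum (RankSelection.percentile p) (fun i => X i ω) n =
        RankSelection.averageRank (RankSelection.percentile p) (fun i => X i ω) n /
          (RankSelection.numRetained (RankSelection.percentile p) (fun i => X i ω) n : ℝ)) ∧
    (∀ᵐ ω ∂μ, Tendsto
      (fun n : ℕ =>
        RankSelection.normalizedRankSum (RankSelection.percentile p) (fun i => X i ω) n)
      atTop (𝓝 (p ^ 2 / (2 * (2 * p - 1))))) ∧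
    (∀ n : ℕ, Integrable
      (fun ω =>
        RankSelection.normalizedRankSum (RankSelection.percentile p) (fun i => X i ω) n) μ) ∧
    Tendsto
      (fun n : ℕ => ∫ ω,
        RankSelection.normalizedRankSum (RankSelection.percentile p) (fun i => X i ω) n ∂μ)
      atTop (𝓝 (p ^ 2 / (2 * (2 * p - 1)))) := by
  open RankSelection in
  have hd : 0 < 2 * p - 1 := by linarith
  have hq0 : 0 ≤ p ^ 2 / (2 * (2 * p - 1)) := by positivity
  have hq : p ^ 2 / (2 * (2 * p - 1)) * (2 * p - 1) = p ^ 2 / 2 := by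
    rw [div_mul_eq_mul_div, mul_div_mul_right _ _ hd.ne']
  obtain ⟨K, D, η, hK, hD, hη, hpot⟩ := sum_potential_le hp hp1 hq0 hq
  have hlim : ∀ N ≥ 1, Tendsto (fun n => ∫ ω in retainedAtLeast X p K N,
      potential p (p ^ 2 / (2 * (2 * p - 1))) D (relRanks (fun j => X j ω) n) ∂μ)
      atTop (𝓝 0) := fun N hN =>
    tendsto_zero_of_contraction hη (fun n => integral_nonneg fun ω => potential_nonneg hD.le _)
      fun n hn => setIntegral_potential_le hX hord hpot hN hn
        (measurableSet_retainedAtLeast hX p K hn) subset_rfl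
  -- The description by relative ranks is valid only without ties, hence almost surely, but
  -- simultaneously for all `n`.
  have hae : ∀ᵐ ω ∂μ, ∀ n, normalizedRankSum (percentile p) (fun i => X i ω) n =
      sumOf p (relRanks (fun j => X j ω) n) / numOf p (relRanks (fun j => X j ω) n) ^ 2 := by
    filter_upwards [ae_injective hX hord] with ω hω n
    rw [normalizedRankSum, rankSum_eq _ hω, numRetained_eq _ hω, sumOf, numOf]
  refine ⟨fun n ω => ?_, ?_, fun n => ?_, ?_⟩
  · rw [normalizedRankSum, averageRank, div_div, sq]
  · filter_upwards [hae, ae_tendsto_of_potential hX hord hp hp1 hK hD hη hpot hlim] with ω h1 h2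
    simpa only [h1] using h2
  · refine (integrable_comp_relRanks hX n fun l => sumOf p l / numOf p l ^ 2).congr ?_
    filter_upwards [hae] with ω h using (h n).symm
  · refine (tendsto_integral_of_potential hX hord hp hp1 hq0 hK hD hlim).congr fun n => ?_
    refine integral_congr_ae ?_
    filter_upwards [hae] with ω h using (h n).symm
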